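/- Let $k$ be a field and $H$ a finite-dimensional Hopf algebra over $k$ with comultiplication $\Delta(h)=h_1\otimes h_2$, counit $\varepsilon$ and antipode $S$ (which is bijective because $H$ is finite-dimensional). Let $H^*$ be the dual algebra, with the convolution product $(\varphi\varphi')(x)=\varphi(x_1)\varphi'(x_2)$ and unit $\varepsilon$, and with the regular actions $(h\rightharpoonup\varphi)(x)=\varphi(xh)$ and $(\varphi\leftharpoonup h)(x)=\varphi(hx)$. Let $D(H)$ be the Drinfeld double, i.e. the space $H^*\otimes H$ with unit $\varepsilon\otimes 1$ and multiplication $$(\varphi\otimes h)(\varphi'\otimes h')=\varphi\,(h_1\rightharpoonup\varphi'\leftharpoonup S^{-1}(h_3))\otimes h_2h'.$$ For algebras $A,B$, a twisting map between $A$ and $B$ is a linear map $R:B\otimes A\to A\otimes B$, $R(b\otimes a)=a_R\otimes b_R$, such that $a_R\otimes 1_R=a\otimes 1$, $1_R\otimes b_R=1\otimes b$, $(aa')_R\otimes b_R=a_Ra'_r\otimes (b_R)_r$ and $a_R\otimes (bb')_R=(a_R)_r\otimes b_rb'_R$ for all $a,a'\in A$, $b,b'\in B$, where $r$ is another copy of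 $R$. The twisted tensor product $A\otimes_R B$ is then the algebra $A\otimes B$ with unit $1\otimes 1$ and multiplication $(a\otimes b)(a'\otimes b')=aa'_R\otimes b_Rb'$. Let $r=r^1\otimes r^2=\mathcal R^1\otimes\mathcal R^2\in H\otimes H$ be an invertible element, with inverse $r^{-1}=u^1\otimes u^2$, such that $$\Delta(r^1)\otimes r^2=\mathcal R^1\otimes r^1\otimes\mathcal R^2r^2,\qquad r^1\otimes\Delta(r^2)=\mathcal R^1r^1\otimes r^2\otimes\mathcal R^2,$$ $$\mathcal R^1\otimes\mathcal R^2_2r^1\otimes\mathcal R^2_1r^2=\mathcal R^1\otimes r^1\mathcal R^2_1\otimes r^2\mathcal R^2_2 .$$ Then: 1. The product $\varphi*\varphi'=(\varphi\leftharpoonup S^{-1}(r^1))(r^2_1\rightharpoonup\varphi'\leftharpoonup S^{-1}(r^2_2))$ makes the vector space $H^*$ an associative algebra with unit $\varepsilon$, denoted by $\underline{H}^*$. 2. The map $R':H\otimes\underline{H}^*\to\underline{H}^*\otimes H$, $R'(h\otimes\varphi)=h_1\rightharpoonup\varphi\leftharpoonup S^{-1}(u^1h_3r^1)\otimes u^2h_2r^2$,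 is a twisting map between $\underline{H}^*$ and $H$. 3. $\underline{H}^*\otimes_{R'}H$ and $D(H)$ are associative unital algebras, and the map $\underline{H}^*\otimes_{R'}H\to D(H)$, $\varphi\otimes h\mapsto\varphi\leftharpoonup S^{-1}(r^1)\otimes r^2h$, is an isomorphism of algebras. -/

import Mathlib

open scoped TensorProduct

namespace HopfDual

section Main
open TensorProduct Coalgebra HopfAlgebra WithConv

section Antipode
variable {k H : Type*} [Field k] [Ring H] [HopfAlgebra k H]

lemma comul_antipode_eq :
    (comul ∘ₗ antipode k : H →ₗ[k] H ⊗[k] H) =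
      TensorProduct.map (antipode k) (antipode k) ∘ₗ
        (TensorProduct.comm k H H).toLinearMap ∘ₗ comul := by
  apply toConv_injective
  refine (left_inv_eq_right_inv (a := toConv (comul : H →ₗ[k] H ⊗[k] H)) ?_
    LinearMap.comul_right_inv).symm
  let i₁ : H →ₐ[k] H ⊗[k] H := Algebra.TensorProduct.includeLeft
  let i₂ : H →ₐ[k] H ⊗[k] H := Algebra.TensorProduct.includeRight
  have hi (i : H →ₐ[k] H ⊗[k] H) :
      toConv (i.toLinearMap ∘ₗ antipode k) * toConv i.toLinearMap = 1 := by
    have := LinearMap.algHom_comp_convMul_distrib i (toConv (antipode k)) (toConv LinearMap.id)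
    rw [LinearMap.antipode_mul_id] at this
    apply ofConv_injective
    simp only [LinearMap.comp_id] at this
    rw [← this]
    ext x
    simp [LinearMap.convOne_def]
  have h1 : toConv (comul : H →ₗ[k] H ⊗[k] H) = toConv i₁.toLinearMap * toConv i₂.toLinearMap := by
    apply ofConv_injective
    ext x
    change comul x = (toConv i₁.toLinearMap * toConv i₂.toLinearMap) x
    rw [(ℛ k x).convMul_apply]
    conv_lhs => rw [← (ℛ k x).eq]
    simp [i₁, i₂]
  have h2 : toConv (TensorProduct.map (antipode k) (antipode k) ∘ₗ
        (TensorProduct.comm k H H).toLinearMap ∘ₗ comul : H →ₗ[k] H ⊗[k] H) =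
      toConv (i₂.toLinearMap ∘ₗ antipode k) * toConv (i₁.toLinearMap ∘ₗ antipode k) := by
    apply ofConv_injective
    ext x
    change _ = (toConv (i₂.toLinearMap ∘ₗ antipode k) * toConv (i₁.toLinearMap ∘ₗ antipode k)) x
    rw [(ℛ k x).convMul_apply]
    simp only [LinearMap.comp_apply]
    conv_lhs => rw [← (ℛ k x).eq]
    simp [i₁, i₂]
  rw [h1, h2, mul_assoc, ← mul_assoc _ (toConv i₁.toLinearMap), hi, one_mul, hi]

lemma coinvariant_step (T : H →ₗ[k] H) (M : H →ₗ[k] H →ₗ[k] H) (hM : ∀ x, M x 1 = x)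
    (hT : ∀ x y, T (x * y) = M (T x) (T y)) (hT1 : T 1 = 1) (h : H)
    (hh : (T ∘ₗ antipode k).lTensor H (comul h) = h ⊗ₜ[k] 1) :
    T.lTensor H (comul h) = h ⊗ₜ[k] 1 := by
  let K : H ⊗[k] H →ₗ[k] H ⊗[k] H :=
    (TensorProduct.lift M).lTensor H ∘ₗ (TensorProduct.assoc k H H H).toLinearMap ∘ₗ
      (T.lTensor H ∘ₗ comul).rTensor H
  have h1 : K (h ⊗ₜ 1) = T.lTensor H (comul h) := by
    have : ∀ t : H ⊗[k] H, (TensorProduct.lift M).lTensor H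
        ((TensorProduct.assoc k H H H) (T.lTensor H t ⊗ₜ[k] (1 : H))) = T.lTensor H t := by
      intro t
      induction t with
      | zero => simp
      | tmul x y => simp [hM]
      | add x y hx hy => simp only [map_add, add_tmul, hx, hy]
    simpa [K] using this (comul h)
  have h2 : ∀ t : H ⊗[k] H, K ((T ∘ₗ antipode k).lTensor H t) =
      (T ∘ₗ LinearMap.mul' k H ∘ₗ (antipode k).lTensor H).lTensor H
        ((TensorProduct.assoc k H H H) (comul.rTensor H t)) := by
    intro t
    induction t with
    | zero => simp
    | tmul x y =>
      have : ∀ s : H ⊗[k] H, (TensorProduct.lift M).lTensor H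
        ((TensorProduct.assoc k H H H) (T.lTensor H s ⊗ₜ[k] (T (antipode k y)))) =
        (T ∘ₗ LinearMap.mul' k H ∘ₗ (antipode k).lTensor H).lTensor H
        ((TensorProduct.assoc k H H H) (s ⊗ₜ y)) := by
        intro s
        induction s with
        | zero => simp
        | tmul x y => simp [hT]
        | add x y hx hy => simp only [map_add, add_tmul, hx, hy]
      simpa [K] using this (comul x)
    | add x y hx hy => simp only [map_add, hx, hy]
  have h3 : K ((T ∘ₗ antipode k).lTensor H (comul h)) = h ⊗ₜ 1 := by
    rw [h2, Coalgebra.coassoc_apply, ← LinearMap.comp_apply, ← LinearMap.lTensor_comp]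
    have : (T ∘ₗ LinearMap.mul' k H ∘ₗ (antipode k).lTensor H) ∘ₗ comul =
        (T ∘ₗ Algebra.linearMap k H) ∘ₗ counit := by
      ext x
      simp
    rw [this, LinearMap.lTensor_comp, LinearMap.comp_apply, Coalgebra.lTensor_counit_comul]
    simp [hT1]
  rw [← h1, ← hh, h3, hh]

lemma antipode_pow_mul (n : ℕ) : ∃ M : H →ₗ[k] H →ₗ[k] H,
    (M = LinearMap.mul k H ∨ M = (LinearMap.mul k H).flip) ∧
    ∀ x y, (antipode k ^ n : H →ₗ[k] H) (x * y) =
      M ((antipode k ^ n : H →ₗ[k] H) x) ((antipode k ^ n : H →ₗ[k] H) y) := by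
  induction n with
  | zero => exact ⟨_, Or.inl rfl, fun x y => rfl⟩
  | succ n ih =>
    obtain ⟨M, hM | hM, h⟩ := ih
    · refine ⟨_, Or.inr rfl, fun x y => ?_⟩
      simp [pow_succ', h, hM, antipode_mul_antidistrib]
    · refine ⟨_, Or.inl rfl, fun x y => ?_⟩
      simp [pow_succ', h, hM, antipode_mul_antidistrib]

lemma antipode_pow_one (n : ℕ) : (antipode k ^ n : H →ₗ[k] H) 1 = 1 := by
  induction n with
  | zero => rfl
  | succ n ih => simp [pow_succ', ih]

lemma coinvariant_descent (n : ℕ) (h : H)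
    (hh : (antipode k ^ n : H →ₗ[k] H).lTensor H (comul h) = h ⊗ₜ[k] 1) :
    h = algebraMap k H (counit h) := by
  induction n with
  | zero =>
    have : comul (R := k) h = h ⊗ₜ 1 := by
      simpa [pow_zero, Module.End.one_eq_id] using hh
    have h2 := Coalgebra.rTensor_counit_comul (R := k) h
    rw [this] at h2
    have := congrArg (TensorProduct.lid k H) h2
    simp at this
    rw [Algebra.algebraMap_eq_smul_one, this]
  | succ n ih =>
    obtain ⟨M, hM, hm⟩ := antipode_pow_mul (k := k) (H := H) n
    refine ih (coinvariant_step _ M ?_ hm (antipode_pow_one n) h ?_)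
    · rcases hM with rfl | rfl <;> simp
    · rwa [pow_succ] at hh

lemma exists_stable_pow [FiniteDimensional k H] (T : Module.End k H) :
    ∃ (m : ℕ) (τ : Module.End k H), Commute T τ ∧
      T ^ (m + 1) * τ * T ^ (m + 1) = T ^ (m + 1) := by
  have hp : minpoly k T ≠ 0 := minpoly.ne_zero (Algebra.IsIntegral.isIntegral T)
  obtain ⟨q, hq, hd⟩ := Polynomial.exists_eq_pow_rootMultiplicity_mul_and_not_dvd _ hp 0
  set m := (minpoly k T).rootMultiplicity 0
  have hc : IsCoprime ((Polynomial.X - Polynomial.C (0 : k)) ^ (m + 1)) q :=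
    ((Polynomial.irreducible_X_sub_C (0 : k)).coprime_iff_not_dvd.2 hd).pow_left
  obtain ⟨a, b, hab⟩ := hc
  have hcT : Commute T (Polynomial.aeval T a) := by
    have := (Commute.all (Polynomial.X : Polynomial k) a).map (Polynomial.aeval T)
    simpa using this
  refine ⟨m, Polynomial.aeval T a, hcT, ?_⟩
  have h0 : Polynomial.aeval T q * T ^ (m + 1) = 0 := by
    have h1 := minpoly.aeval k T
    rw [hq, mul_comm] at h1
    rw [pow_succ, ← mul_assoc]
    simpa using congrArg (· * T) h1
  have h2 : Polynomial.aeval T a * T ^ (m + 1) + Polynomial.aeval T b * Polynomial.aeval T q = 1 := by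
    simpa using congrArg (Polynomial.aeval T) hab
  have h3 := congrArg (· * T ^ (m + 1)) h2
  simp only [add_mul, mul_assoc, h0, mul_zero, add_zero, one_mul] at h3
  rw [(hcT.pow_left (m + 1)).eq, mul_assoc, h3]

lemma comul_antipode_sq_pow (m : ℕ) :
    (comul ∘ₗ ((antipode k ^ 2 : Module.End k H) ^ m : Module.End k H) : H →ₗ[k] H ⊗[k] H) =
      TensorProduct.map ((antipode k ^ 2 : Module.End k H) ^ m)
        ((antipode k ^ 2 : Module.End k H) ^ m) ∘ₗ comul := by
  have h2 : (comul ∘ₗ (antipode k ^ 2 : Module.End k H) : H →ₗ[k] H ⊗[k] H) =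
      TensorProduct.map (antipode k ^ 2 : Module.End k H) (antipode k ^ 2 : Module.End k H) ∘ₗ
        comul := by
    rw [pow_two, Module.End.mul_eq_comp, ← LinearMap.comp_assoc, comul_antipode_eq,
      LinearMap.comp_assoc, LinearMap.comp_assoc, comul_antipode_eq, TensorProduct.map_comp]
    ext x
    simp only [LinearMap.comp_apply]
    generalize (comul x : H ⊗[k] H) = t
    induction t with
    | zero => simp
    | tmul x y => simp
    | add x y hx hy => simp only [map_add, hx, hy]
  induction m with
  | zero => simp [Module.End.one_eq_id]
  | succ m ih =>
    rw [pow_succ, Module.End.mul_eq_comp, ← LinearMap.comp_assoc, ih, LinearMap.comp_assoc, h2,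
      TensorProduct.map_comp, LinearMap.comp_assoc]

lemma counit_antipode_pow (n : ℕ) (x : H) :
    counit (R := k) ((antipode k ^ n : Module.End k H) x) = counit (R := k) x := by
  induction n with
  | zero => rfl
  | succ n ih => simp [pow_succ', ih]

lemma antipode_sq_pow_mul (m : ℕ) (x y : H) :
    ((antipode k ^ 2 : Module.End k H) ^ m) (x * y) =
      ((antipode k ^ 2 : Module.End k H) ^ m) x * ((antipode k ^ 2 : Module.End k H) ^ m) y := by
  induction m with
  | zero => rfl
  | succ m ih =>
    rw [pow_succ', Module.End.mul_apply, ih, pow_two]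
    simp only [Module.End.mul_apply, antipode_mul_antidistrib]

/-- The antipode of a finite-dimensional Hopf algebra is bijective. -/
theorem antipode_bijective [FiniteDimensional k H] :
    Function.Bijective (antipode k : H →ₗ[k] H) := by
  obtain ⟨m, τ, hc, hτ⟩ := exists_stable_pow (antipode k ^ 2 : Module.End k H)
  obtain ⟨σ, hσ⟩ : ∃ σ, σ = (antipode k ^ 2 : Module.End k H) ^ (m + 1) := ⟨_, rfl⟩
  have hΔ : comul ∘ₗ σ = TensorProduct.map σ σ ∘ₗ (comul : H →ₗ[k] H ⊗[k] H) := by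
    rw [hσ]; exact comul_antipode_sq_pow (m + 1)
  have hε : ∀ x, counit (R := k) (σ x) = counit (R := k) x := by
    intro x
    rw [hσ, ← pow_mul]
    exact counit_antipode_pow _ x
  have hσS : σ * antipode k = antipode k * σ := by
    rw [hσ]
    exact (((Commute.refl (antipode k : Module.End k H)).pow_left 2).pow_left (m + 1)).eq
  have hmul : ∀ x y, σ (x * y) = σ x * σ y := by
    rw [hσ]; exact antipode_sq_pow_mul _
  have hone : σ 1 = 1 := by
    rw [hσ, ← pow_mul]
    exact antipode_pow_one _
  have hστ : σ * τ = τ * σ := by rw [hσ]; exact (hc.pow_left (m + 1)).eq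
  have hfac : σ = antipode k * (antipode k * (antipode k ^ 2 : Module.End k H) ^ m) := by
    rw [hσ, pow_succ', pow_two, mul_assoc]
  rw [← hσ] at hτ
  obtain ⟨π, hπ⟩ : ∃ π, π = σ * τ := ⟨_, rfl⟩
  have hπ' : π = τ * σ := hπ.trans hστ
  have hσπ : σ * π = σ := by rw [hπ', ← mul_assoc, hτ]
  have hπσ : π * σ = σ := by rw [hπ, hτ]
  have hεπ : ∀ x, counit (R := k) (π x) = counit (R := k) x := by
    intro x
    have h1 : ∀ x, counit (R := k) (π x) = counit (R := k) (τ x) := by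
      intro x; rw [hπ]; exact hε (τ x)
    have h2 : π (σ x) = σ x := LinearMap.congr_fun hπσ x
    have h3 : π x = τ (σ x) := LinearMap.congr_fun hπ' x
    rw [h3, ← h1, h2, hε]
  have hΔπ : comul ∘ₗ π = TensorProduct.map π π ∘ₗ (comul : H →ₗ[k] H ⊗[k] H) := by
    have e1 : comul ∘ₗ π = TensorProduct.map σ σ ∘ₗ (comul : H →ₗ[k] H ⊗[k] H) ∘ₗ τ := by
      rw [hπ, Module.End.mul_eq_comp, ← LinearMap.comp_assoc, hΔ, LinearMap.comp_assoc]
    have e2 : TensorProduct.map π π ∘ₗ (comul : H →ₗ[k] H ⊗[k] H) =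
        TensorProduct.map τ τ ∘ₗ comul ∘ₗ σ := by
      rw [hΔ, ← LinearMap.comp_assoc, ← TensorProduct.map_comp, hπ', Module.End.mul_eq_comp]
    have e3 : TensorProduct.map τ τ ∘ₗ comul ∘ₗ σ =
        TensorProduct.map π π ∘ₗ (comul : H →ₗ[k] H ⊗[k] H) ∘ₗ π := by
      conv_lhs => rw [← hσπ, Module.End.mul_eq_comp, ← LinearMap.comp_assoc _ _ comul, hΔ]
      rw [LinearMap.comp_assoc, ← LinearMap.comp_assoc _ _ (TensorProduct.map τ τ),
        ← TensorProduct.map_comp, hπ', Module.End.mul_eq_comp]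
    rw [e2, e3, e1, ← LinearMap.comp_assoc _ _ (TensorProduct.map π π), ← TensorProduct.map_comp, ← Module.End.mul_eq_comp,
      hπσ]
  let πc : H →ₗc[k] H := { π with
    counit_comp := by ext x; exact hεπ x
    map_comp_comul := hΔπ.symm }
  have hinv : toConv (antipode k ∘ₗ π) * toConv π = 1 := by
    have := LinearMap.convMul_comp_coalgHom_distrib (toConv (antipode k)) (toConv LinearMap.id) πc
    rw [LinearMap.antipode_mul_id] at this
    apply ofConv_injective
    refine Eq.trans this.symm ?_
    ext x
    exact congrArg (algebraMap k H) (hεπ x)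
  let i₁ : H →ₐ[k] H ⊗[k] H := Algebra.TensorProduct.includeLeft
  let i₂ : H →ₐ[k] H ⊗[k] H := Algebra.TensorProduct.includeRight
  let σA : H →ₐ[k] H := AlgHom.ofLinearMap σ hone hmul
  let E : H →ₐ[k] H ⊗[k] H :=
    (Algebra.TensorProduct.map (AlgHom.id k H) σA).comp (Bialgebra.comulAlgHom k H)
  have hE1 : toConv E.toLinearMap = toConv i₁.toLinearMap * toConv (i₂.comp σA).toLinearMap := by
    apply ofConv_injective
    ext x
    change _ = (toConv i₁.toLinearMap * toConv (i₂.comp σA).toLinearMap) x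
    rw [(ℛ k x).convMul_apply]
    simp only [E, AlgHom.comp_toLinearMap, LinearMap.comp_apply, AlgHom.toLinearMap_apply,
      Bialgebra.comulAlgHom_apply]
    conv_lhs => rw [← (ℛ k x).eq]
    simp [i₁, i₂]
  have hE2 : toConv (E.toLinearMap ∘ₗ antipode k ∘ₗ π) =
      toConv ((i₂.comp σA).toLinearMap ∘ₗ antipode k) *
        toConv (i₁.toLinearMap ∘ₗ antipode k ∘ₗ π) := by
    apply ofConv_injective
    ext x
    change _ = (toConv ((i₂.comp σA).toLinearMap ∘ₗ antipode k) *
        toConv (i₁.toLinearMap ∘ₗ antipode k ∘ₗ π)) x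
    rw [(ℛ k x).convMul_apply]
    have e1 : comul (antipode k (π x)) = TensorProduct.map (antipode k) (antipode k)
        (TensorProduct.comm k H H (TensorProduct.map π π (comul x))) := by
      have h1 := LinearMap.congr_fun (comul_antipode_eq (k := k) (H := H)) (π x)
      have h2 := LinearMap.congr_fun hΔπ x
      simp only [LinearMap.comp_apply] at h1 h2
      rw [h1, h2]; rfl
    have e2 : ∀ y, σ (antipode k (π y)) = σ (antipode k y) := by
      intro y
      have := LinearMap.congr_fun (show σ * antipode k * π = σ * antipode k by
        rw [hσS, mul_assoc, hσπ]) y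
      exact this
    simp only [E, AlgHom.comp_toLinearMap, LinearMap.comp_apply, AlgHom.toLinearMap_apply,
      Bialgebra.comulAlgHom_apply, e1]
    conv_lhs => rw [← (ℛ k x).eq]
    simp [i₁, i₂, σA, e2]
  have hE3 : toConv (i₂.comp σA).toLinearMap *
      toConv ((i₂.comp σA).toLinearMap ∘ₗ antipode k) = 1 := by
    have := LinearMap.algHom_comp_convMul_distrib (i₂.comp σA) (toConv LinearMap.id)
      (toConv (antipode k))
    rw [LinearMap.id_mul_antipode] at this
    apply ofConv_injective
    refine Eq.trans this.symm ?_
    ext x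
    simp [LinearMap.convOne_def]
  have hcoinv : E.toLinearMap ∘ₗ (toConv LinearMap.id * toConv (antipode k ∘ₗ π)).ofConv =
      i₁.toLinearMap ∘ₗ (toConv LinearMap.id * toConv (antipode k ∘ₗ π)).ofConv := by
    rw [LinearMap.algHom_comp_convMul_distrib, LinearMap.algHom_comp_convMul_distrib]
    simp only [LinearMap.comp_id]
    rw [hE2, hE1, mul_assoc, ← mul_assoc _ _ (toConv (i₁.toLinearMap ∘ₗ antipode k ∘ₗ π)), hE3,
      one_mul]
  have hεid : ∀ x, counit (R := k) ((toConv LinearMap.id * toConv (antipode k ∘ₗ π)).ofConv x) =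
      counit (R := k) x := by
    intro x
    have h1 := LinearMap.algHom_comp_convMul_distrib (Bialgebra.counitAlgHom k H)
      (toConv LinearMap.id) (toConv (antipode k ∘ₗ π))
    have h2 : toConv ((Bialgebra.counitAlgHom k H).toLinearMap ∘ₗ LinearMap.id) = 1 := rfl
    have h3 : toConv ((Bialgebra.counitAlgHom k H).toLinearMap ∘ₗ antipode k ∘ₗ π) = 1 := by
      apply ofConv_injective
      ext x
      simp [hεπ, LinearMap.convOne_def]
    change (Bialgebra.counitAlgHom k H).toLinearMap ∘ₗ _ = _ at h1
    simp only [h2, h3, mul_one] at h1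
    exact LinearMap.congr_fun h1 x
  have hid : toConv LinearMap.id * toConv (antipode k ∘ₗ π) = 1 := by
    apply ofConv_injective
    ext x
    have h1 := coinvariant_descent (k := k) (2 * (m + 1))
      ((toConv LinearMap.id * toConv (antipode k ∘ₗ π)).ofConv x) (by
        rw [pow_mul, ← hσ]
        exact LinearMap.congr_fun hcoinv x)
    rw [h1, hεid]
    rfl
  have hπid : π = 1 := by
    have := left_inv_eq_right_inv hid hinv
    exact (toConv_injective this).symm
  have hsurj : Function.Surjective (antipode k : H →ₗ[k] H) := by
    intro x
    refine ⟨(antipode k * (antipode k ^ 2) ^ m * τ : Module.End k H) x, ?_⟩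
    have := LinearMap.congr_fun hπid x
    rw [hπ, hfac] at this
    exact this
  exact ⟨LinearMap.injective_iff_surjective.2 hsurj, hsurj⟩

end Antipode
section Twisted
variable {k A B : Type*} [Field k] [AddCommGroup A] [Module k A] [AddCommGroup B] [Module k B]

/-- The bilinear multiplication `m` with unit `e` makes the vector space `A` an associative
unital algebra. -/
structure IsAlgebraStructure (m : A →ₗ[k] A →ₗ[k] A) (e : A) : Prop where
  assoc : ∀ x y z, m (m x y) z = m x (m y z)
  one_mul : ∀ x, m e x = x
  mul_one : ∀ x, m x e = x

/-- `R : B ⊗ A → A ⊗ B` is a twisting map between the algebras `(A, mA, eA)` and `(B, mB, eB)`.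
With `R (b ⊗ a) = a_R ⊗ b_R` and `r` another copy of `R`, the four conditions are
`a_R ⊗ 1_R = a ⊗ 1`, `1_R ⊗ b_R = 1 ⊗ b`, `(a a')_R ⊗ b_R = a_R a'_r ⊗ (b_R)_r` and
`a_R ⊗ (b b')_R = (a_R)_r ⊗ b_r b'_R`. -/
structure IsTwistingMap (mA : A →ₗ[k] A →ₗ[k] A) (eA : A) (mB : B →ₗ[k] B →ₗ[k] B) (eB : B)
    (R : B ⊗[k] A →ₗ[k] A ⊗[k] B) : Prop where
  map_one_left : ∀ a, R (eB ⊗ₜ a) = a ⊗ₜ eB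
  map_one_right : ∀ b, R (b ⊗ₜ eA) = eA ⊗ₜ b
  map_mul_right : ∀ b a a', R (b ⊗ₜ mA a a') =
    (TensorProduct.lift mA).rTensor B ((TensorProduct.assoc k A A B).symm
      (R.lTensor A (TensorProduct.assoc k A B A (R (b ⊗ₜ a) ⊗ₜ a'))))
  map_mul_left : ∀ b b' a, R (mB b b' ⊗ₜ a) =
    (TensorProduct.lift mB).lTensor A (TensorProduct.assoc k A B B
      (R.rTensor B ((TensorProduct.assoc k B A B).symm (b ⊗ₜ R (b' ⊗ₜ a)))))

/-- The multiplication `(a ⊗ b)(a' ⊗ b') = a a'_R ⊗ b_R b'` on `A ⊗ B`. -/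
noncomputable def twistedMul (mA : A →ₗ[k] A →ₗ[k] A) (mB : B →ₗ[k] B →ₗ[k] B)
    (R : B ⊗[k] A →ₗ[k] A ⊗[k] B) : A ⊗[k] B →ₗ[k] A ⊗[k] B →ₗ[k] A ⊗[k] B :=
  TensorProduct.curry
    (TensorProduct.map (TensorProduct.lift mA) (TensorProduct.lift mB) ∘ₗ
      (TensorProduct.assoc k A A (B ⊗[k] B)).symm.toLinearMap ∘ₗ
      LinearMap.lTensor A ((TensorProduct.assoc k A B B).toLinearMap ∘ₗ
        R.rTensor B ∘ₗ (TensorProduct.assoc k B A B).symm.toLinearMap) ∘ₗ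
      (TensorProduct.assoc k A B (A ⊗[k] B)).toLinearMap)

theorem twistedMul_tmul (mA : A →ₗ[k] A →ₗ[k] A) (mB : B →ₗ[k] B →ₗ[k] B)
    (R : B ⊗[k] A →ₗ[k] A ⊗[k] B) (a a' : A) (b b' : B) :
    twistedMul mA mB R (a ⊗ₜ b) (a' ⊗ₜ b') =
      TensorProduct.map (mA a) (mB.flip b') (R (b ⊗ₜ a')) := by
  simp only [twistedMul, TensorProduct.curry_apply, LinearMap.comp_apply, LinearEquiv.coe_coe,
    TensorProduct.assoc_tmul, LinearMap.lTensor_tmul, TensorProduct.assoc_symm_tmul,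
    LinearMap.rTensor_tmul]
  generalize R (b ⊗ₜ a') = t
  induction t with
  | zero => simp
  | tmul x y => simp
  | add x y hx hy => simp only [map_add, add_tmul, tmul_add, hx, hy]

end Twisted

section Dual
variable {k H : Type*} [Field k] [Ring H] [HopfAlgebra k H]

/-- The multiplication of `H*`: the convolution product
`(φ ψ)(x) = φ(x_1) ψ(x_2)`. Its unit is the counit of `H`. -/
noncomputable def dualMul :
    Module.Dual k H →ₗ[k] Module.Dual k H →ₗ[k] Module.Dual k H :=
  LinearMap.mk₂ k (fun φ ψ => (toConv φ * toConv ψ).ofConv)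
    (fun φ φ' ψ => by simp [add_mul])
    (fun c φ ψ => congrArg ofConv (smul_mul_assoc c (toConv φ) (toConv ψ)))
    (fun φ ψ ψ' => by simp [mul_add])
    (fun c φ ψ => congrArg ofConv (mul_smul_comm c (toConv φ) (toConv ψ)))

/-- The left regular action of `H` on `H*`: `(h ⇀ φ)(x) = φ(x h)`. -/
def hitLeft : H →ₗ[k] Module.Dual k H →ₗ[k] Module.Dual k H :=
  LinearMap.mk₂ k (fun h φ => φ ∘ₗ LinearMap.mulRight k h)
    (fun h h' φ => by ext; simp [mul_add]) (fun c h φ => by ext; simp)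
    (fun h φ φ' => by ext; simp) (fun c h φ => by ext; simp)

/-- The right regular action of `H` on `H*`: `(φ ↼ h)(x) = φ(h x)`. -/
def hitRight : Module.Dual k H →ₗ[k] H →ₗ[k] Module.Dual k H :=
  LinearMap.mk₂ k (fun φ h => φ ∘ₗ LinearMap.mulLeft k h)
    (fun φ φ' h => by ext; simp) (fun c φ h => by ext; simp)
    (fun φ h h' => by ext; simp [add_mul]) (fun c φ h => by ext; simp)

theorem dualMul_apply (φ ψ : Module.Dual k H) (x : H) :
    dualMul φ ψ x = LinearMap.mul' k k (TensorProduct.map φ ψ (comul x)) := rfl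

theorem hitLeft_apply (h : H) (φ : Module.Dual k H) (x : H) : hitLeft h φ x = φ (x * h) := rfl

theorem hitRight_apply (φ : Module.Dual k H) (h x : H) : hitRight φ h x = φ (h * x) := rfl

variable [FiniteDimensional k H]

variable (k H) in
/-- The inverse `S⁻¹` of the antipode. -/
noncomputable def antipodeInv : H →ₗ[k] H :=
  (LinearEquiv.ofBijective (antipode k) antipode_bijective).symm.toLinearMap

theorem antipodeInv_antipode (x : H) : antipodeInv k H (antipode k x) = x :=
  (LinearEquiv.ofBijective (antipode k : H →ₗ[k] H) antipode_bijective).symm_apply_apply x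

theorem antipode_antipodeInv (x : H) : antipode k (antipodeInv k H x) = x :=
  (LinearEquiv.ofBijective (antipode k : H →ₗ[k] H) antipode_bijective).apply_symm_apply x

/-- `(φ, t) ↦ φ ↼ S⁻¹(t^1) ⊗ t^2`. -/
noncomputable def hitTensor :
    Module.Dual k H →ₗ[k] H ⊗[k] H →ₗ[k] Module.Dual k H ⊗[k] H :=
  LinearMap.rTensorHom H ∘ₗ hitRight.compl₂ (antipodeInv k H)

theorem hitTensor_tmul (φ : Module.Dual k H) (x y : H) :
    hitTensor φ (x ⊗ₜ[k] y) = hitRight φ (antipodeInv k H x) ⊗ₜ[k] y := rfl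

/-- `(h, φ) ↦ h · φ = h_1 ⇀ φ ↼ S⁻¹(h_2)`. -/
noncomputable def dotAction : H →ₗ[k] Module.Dual k H →ₗ[k] Module.Dual k H :=
  LinearMap.mk₂ k
    (fun h φ => TensorProduct.lift
      ((hitRight.compl₂ (antipodeInv k H)) ∘ₗ hitLeft.flip φ) (comul h))
    (fun h h' φ => by simp) (fun c h φ => by simp)
    (fun h φ φ' => by
      rw [← LinearMap.add_apply]; congr 1; apply TensorProduct.ext'; intro x y; simp)
    (fun c h φ => by
      rw [← LinearMap.smul_apply]; congr 1; apply TensorProduct.ext'; intro x y; simp)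

/-- The product `φ * φ' = (φ ↼ S⁻¹(r^1)) (r^2_1 ⇀ φ' ↼ S⁻¹(r^2_2))` on `H*`
defined by `r = r^1 ⊗ r^2`. -/
noncomputable def starMul (r : H ⊗[k] H) :
    Module.Dual k H →ₗ[k] Module.Dual k H →ₗ[k] Module.Dual k H :=
  LinearMap.mk₂ k
    (fun φ φ' => TensorProduct.lift dualMul
      (TensorProduct.map (hitRight φ ∘ₗ antipodeInv k H) (dotAction.flip φ') r))
    (fun φ ψ φ' => by simp [LinearMap.add_comp, TensorProduct.map_add_left])
    (fun c φ φ' => by simp [LinearMap.smul_comp, TensorProduct.map_smul_left])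
    (fun φ φ' ψ => by simp [TensorProduct.map_add_right])
    (fun c φ φ' => by simp [TensorProduct.map_smul_right])

/-- For `u = u^1 ⊗ u^2` and `v = v^1 ⊗ v^2`, the linear map `H ⊗ H* → H* ⊗ H`,
`h ⊗ φ ↦ h_1 ⇀ φ ↼ S⁻¹(u^1 h_3 v^1) ⊗ u^2 h_2 v^2`.
Here `u^1 h_3 v^1 ⊗ u^2 h_2 v^2` is the product `u (h_3 ⊗ h_2) v` in `H ⊗ H`. -/
noncomputable def twistMap (u v : H ⊗[k] H) :
    H ⊗[k] Module.Dual k H →ₗ[k] Module.Dual k H ⊗[k] H :=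
  TensorProduct.lift <| LinearMap.mk₂ k
    (fun h φ => TensorProduct.lift
      ((hitTensor ∘ₗ hitLeft.flip φ).compl₂
        (LinearMap.mulLeft k u ∘ₗ LinearMap.mulRight k v ∘ₗ
          (TensorProduct.comm k H H).toLinearMap))
      (comul.lTensor H (comul h)))
    (fun h h' φ => by simp) (fun c h φ => by simp)
    (fun h φ φ' => by
      rw [← LinearMap.add_apply]; congr 1; apply TensorProduct.ext'; intro x y; simp)
    (fun c h φ => by
      rw [← LinearMap.smul_apply]; congr 1; apply TensorProduct.ext'; intro x y; simp)

variable (k H) in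
/-- The multiplication of the Drinfeld double `D(H)` on `H* ⊗ H`:
`(φ ⊗ h)(φ' ⊗ h') = φ (h_1 ⇀ φ' ↼ S⁻¹(h_3)) ⊗ h_2 h'`. Its unit is `ε ⊗ 1`. -/
noncomputable def doubleMul :
    Module.Dual k H ⊗[k] H →ₗ[k] Module.Dual k H ⊗[k] H →ₗ[k] Module.Dual k H ⊗[k] H :=
  twistedMul dualMul (LinearMap.mul k H) (twistMap 1 1)

end Dual

section Conditions
variable {k H : Type*} [Field k] [Ring H] [HopfAlgebra k H]

/-- `r_12 = r^1 ⊗ r^2 ⊗ 1`. -/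
noncomputable def leg12 (r : H ⊗[k] H) : H ⊗[k] (H ⊗[k] H) :=
  LinearMap.lTensor H ((TensorProduct.mk k H H).flip 1) r

/-- `r_13 = r^1 ⊗ 1 ⊗ r^2`. -/
noncomputable def leg13 (r : H ⊗[k] H) : H ⊗[k] (H ⊗[k] H) :=
  LinearMap.lTensor H (TensorProduct.mk k H H 1) r

/-- `r_23 = 1 ⊗ r^1 ⊗ r^2`. -/
def leg23 (r : H ⊗[k] H) : H ⊗[k] (H ⊗[k] H) := 1 ⊗ₜ[k] r

/-- The three conditions on `r = r^1 ⊗ r^2 = R^1 ⊗ R^2`: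
`Δ(r^1) ⊗ r^2 = R^1 ⊗ r^1 ⊗ R^2 r^2`, `r^1 ⊗ Δ(r^2) = R^1 r^1 ⊗ r^2 ⊗ R^2` and
`R^1 ⊗ R^2_2 r^1 ⊗ R^2_1 r^2 = R^1 ⊗ r^1 R^2_1 ⊗ r^2 R^2_2`. The right-hand sides of the first
two are the products `r_13 r_23` and `r_13 r_12` in `H ⊗ H ⊗ H`. -/
structure SatisfiesSQT (r : H ⊗[k] H) : Prop where
  sqt1 : TensorProduct.assoc k H H H (comul.rTensor H r) = leg13 r * leg23 r
  sqt2 : comul.lTensor H r = leg13 r * leg12 r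
  sqt3 : ((TensorProduct.comm k H H).toLinearMap ∘ₗ comul).lTensor H r * leg23 r =
    leg23 r * comul.lTensor H r

end Conditions

end Main

end HopfDual

/-! Everything is read off inside the double. Suppose an algebra `D` has unital multiplicative maps
`f : A → D` and `j : B → D` such that `g : a ⊗ b ↦ f(a) j(b)` is bijective. Then the map `R` that
rewrites `j(b) f(a)` as `g (R (b ⊗ a))` is automatically a twisting map, `g` is an isomorphism from
the twisted tensor product to `D`, and `A` inherits associativity from `D` because `f` is injective.
No law of `A` is assumed, so all parts of the theorem follow at once from `IsFactorization`.

Here `D = D(H)`, `j(h) = ε ⊗ h` and `f(φ) = φ ↼ S⁻¹(r^1) ⊗ r^2`. The map `g` is the action of `r`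
under the representation `opTensor` of `H ⊗ H` on `H* ⊗ H`, hence bijective since `r` is a unit. By
`twistMap_tmul`, `R'(h ⊗ φ)` applies `r`, then left multiplication by `ε ⊗ h`, then `r⁻¹` to `φ ⊗
1`, so it is the required rewriting map.

Three facts remain. `D(H)` is associative (`isAlgebraStructure_doubleMul`): left multiplications are
products of operators `opDual φ` and `opDouble h`, with one commutation rule. The map `f` is unital,
because `ε(r^1) r^2 = 1` (`SatisfiesSQT.counit_rTensor`). The map `f` is multiplicative, which
reduces to an identity in `H ⊗ H ⊗ H ⊗ H` (`SatisfiesSQT.four_legs`). -/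

namespace HopfDual
open TensorProduct Coalgebra HopfAlgebra WithConv

/-! ### Algebra factorizations and twisting maps. -/

section Factorization
variable {k A B D : Type*} [Field k] [AddCommGroup A] [Module k A] [AddCommGroup B] [Module k B]
  [AddCommGroup D] [Module k D]

/-- The linear isomorphism `g : A ⊗ B → D`, `a ⊗ b ↦ f(a) j(b)`, exhibits the algebra `(D, m, e)`
as factorized through `(A, mA, eA)` and `(B, mB, eB)`, and `R` rewrites `j(b) f(a)`. -/
structure IsFactorization (mA : A →ₗ[k] A →ₗ[k] A) (eA : A) (mB : B →ₗ[k] B →ₗ[k] B) (eB : B)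
    (m : D →ₗ[k] D →ₗ[k] D) (e : D) (R : B ⊗[k] A →ₗ[k] A ⊗[k] B)
    (f : A →ₗ[k] D) (j : B →ₗ[k] D) (g : (A ⊗[k] B) ≃ₗ[k] D) : Prop where
  map_mulA : ∀ a a', f (mA a a') = m (f a) (f a')
  map_oneA : f eA = e
  map_mulB : ∀ b b', j (mB b b') = m (j b) (j b')
  map_oneB : j eB = e
  equiv_tmul : ∀ a b, g (a ⊗ₜ b) = m (f a) (j b)
  equiv_twist : ∀ b a, g (R (b ⊗ₜ a)) = m (j b) (f a)

namespace IsFactorization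
variable {mA : A →ₗ[k] A →ₗ[k] A} {eA : A} {mB : B →ₗ[k] B →ₗ[k] B} {eB : B}
  {m : D →ₗ[k] D →ₗ[k] D} {e : D} {R : B ⊗[k] A →ₗ[k] A ⊗[k] B}
  {f : A →ₗ[k] D} {j : B →ₗ[k] D} {g : (A ⊗[k] B) ≃ₗ[k] D}

theorem equiv_mul_left (F : IsFactorization mA eA mB eB m e R f j g)
    (hD : IsAlgebraStructure m e) (a : A) (t : A ⊗[k] B) :
    g ((TensorProduct.lift mA).rTensor B ((TensorProduct.assoc k A A B).symm (a ⊗ₜ t))) =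
      m (f a) (g t) := by
  induction t with
  | zero => simp
  | tmul x y => simp [F.equiv_tmul, F.map_mulA, hD.assoc]
  | add x y hx hy => simp only [map_add, tmul_add, hx, hy]

theorem equiv_mul_right (F : IsFactorization mA eA mB eB m e R f j g)
    (hD : IsAlgebraStructure m e) (t : A ⊗[k] B) (b : B) :
    g ((TensorProduct.lift mB).lTensor A (TensorProduct.assoc k A B B (t ⊗ₜ b))) =
      m (g t) (j b) := by
  induction t with
  | zero => simp
  | tmul x y => simp [F.equiv_tmul, F.map_mulB, hD.assoc]
  | add x y hx hy => simp only [map_add, add_tmul, hx, hy, LinearMap.add_apply]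

/-- After applying the injective `g`, the unit axioms become unit laws of `D`, and the two
multiplicativity axioms become the associativity of `j(b) f(a) f(a')` and `j(b) j(b') f(a)`. -/
theorem isTwistingMap (F : IsFactorization mA eA mB eB m e R f j g)
    (hD : IsAlgebraStructure m e) : IsTwistingMap mA eA mB eB R where
  map_one_left a := g.injective <| by
    rw [F.equiv_twist, F.equiv_tmul, F.map_oneB, hD.one_mul, hD.mul_one]
  map_one_right b := g.injective <| by
    rw [F.equiv_twist, F.equiv_tmul, F.map_oneA, hD.one_mul, hD.mul_one]
  map_mul_right b a a' := g.injective <| by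
    -- Replacing `R (b ⊗ a)` by an arbitrary `t` allows reduction to pure tensors.
    have key : ∀ t : A ⊗[k] B, g ((TensorProduct.lift mA).rTensor B
        ((TensorProduct.assoc k A A B).symm
          (R.lTensor A (TensorProduct.assoc k A B A (t ⊗ₜ a'))))) = m (g t) (f a') := by
      intro t
      induction t with
      | zero => simp
      | tmul x y =>
        rw [TensorProduct.assoc_tmul, LinearMap.lTensor_tmul, F.equiv_mul_left hD, F.equiv_twist,
          F.equiv_tmul, hD.assoc]
      | add x y hx hy => simp only [map_add, add_tmul, hx, hy, LinearMap.add_apply]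
    rw [key, F.equiv_twist, F.equiv_twist, F.map_mulA, hD.assoc]
  map_mul_left b b' a := g.injective <| by
    have key : ∀ t : A ⊗[k] B, g ((TensorProduct.lift mB).lTensor A
        (TensorProduct.assoc k A B B
          (R.rTensor B ((TensorProduct.assoc k B A B).symm (b ⊗ₜ t))))) = m (j b) (g t) := by
      intro t
      induction t with
      | zero => simp
      | tmul x y =>
        rw [TensorProduct.assoc_symm_tmul, LinearMap.rTensor_tmul, F.equiv_mul_right hD,
          F.equiv_twist, F.equiv_tmul, hD.assoc]
      | add x y hx hy => simp only [map_add, tmul_add, hx, hy]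
    rw [key, F.equiv_twist, F.equiv_twist, F.map_mulB, hD.assoc]

theorem equiv_twistedMul (F : IsFactorization mA eA mB eB m e R f j g)
    (hD : IsAlgebraStructure m e) (x y : A ⊗[k] B) :
    g (twistedMul mA mB R x y) = m (g x) (g y) := by
  induction x with
  | zero => simp
  | add x x' hx hx' => simp only [map_add, LinearMap.add_apply, hx, hx']
  | tmul a b =>
    induction y with
    | zero => simp
    | add y y' hy hy' => simp only [map_add, hy, hy']
    | tmul a' b' =>
      have key : ∀ t : A ⊗[k] B, g (TensorProduct.map (mA a) (mB.flip b') t) =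
          m (f a) (m (g t) (j b')) := by
        intro t
        induction t with
        | zero => simp
        | tmul x y => simp [F.equiv_tmul, F.map_mulA, F.map_mulB, hD.assoc]
        | add x y hx hy => simp only [map_add, hx, hy, LinearMap.add_apply]
      rw [twistedMul_tmul, key, F.equiv_twist, F.equiv_tmul, F.equiv_tmul]
      simp only [hD.assoc]

theorem equiv_one (F : IsFactorization mA eA mB eB m e R f j g)
    (hD : IsAlgebraStructure m e) : g (eA ⊗ₜ eB) = e := by
  rw [F.equiv_tmul, F.map_oneA, F.map_oneB, hD.one_mul]

theorem isAlgebraStructure_twistedMul (F : IsFactorization mA eA mB eB m e R f j g)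
    (hD : IsAlgebraStructure m e) :
    IsAlgebraStructure (twistedMul mA mB R) (eA ⊗ₜ[k] eB) where
  assoc x y z := g.injective <| by simp only [F.equiv_twistedMul hD, hD.assoc]
  one_mul x := g.injective <| by rw [F.equiv_twistedMul hD, F.equiv_one hD, hD.one_mul]
  mul_one x := g.injective <| by rw [F.equiv_twistedMul hD, F.equiv_one hD, hD.mul_one]

/-- The laws hold in `D` and are pulled back along `f`, which is injective because `f(a) = g (a ⊗
eB)` and `eB` is nonzero. -/
theorem isAlgebraStructure_left (F : IsFactorization mA eA mB eB m e R f j g)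
    (hD : IsAlgebraStructure m e) (heB : eB ≠ 0) : IsAlgebraStructure mA eA := by
  have hf : Function.Injective f := by
    have h1 : ∀ a, f a = g (a ⊗ₜ eB) := fun a => by
      rw [F.equiv_tmul, F.map_oneB, hD.mul_one]
    -- A functional not vanishing at `eB` recovers `a`, up to a nonzero scalar, from `a ⊗ eB`.
    obtain ⟨l, hl⟩ := Module.Projective.exists_dual_ne_zero k heB
    refine (injective_iff_map_eq_zero f).2 fun a ha => ?_
    rw [h1, LinearEquiv.map_eq_zero_iff] at ha
    have := congrArg (TensorProduct.rid k A ∘ l.lTensor A) ha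
    simpa [hl] using this
  exact
    { assoc := fun x y z => hf <| by simp only [F.map_mulA, hD.assoc]
      one_mul := fun x => hf <| by rw [F.map_mulA, F.map_oneA, hD.one_mul]
      mul_one := fun x => hf <| by rw [F.map_mulA, F.map_oneA, hD.mul_one] }

end IsFactorization
end Factorization

/-! ### The regular actions on `H*` and the inverse antipode. -/

section DualActions
variable {k H : Type*} [Field k] [Ring H] [HopfAlgebra k H]

theorem isAlgebraStructure_dualMul :
    IsAlgebraStructure (dualMul (k := k) (H := H)) (counit : Module.Dual k H) where
  assoc φ ψ χ := congrArg ofConv (mul_assoc (toConv φ) (toConv ψ) (toConv χ))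
  one_mul φ := congrArg ofConv (_root_.one_mul (toConv φ))
  mul_one φ := congrArg ofConv (_root_.mul_one (toConv φ))

theorem hitLeft_mul (x y : H) (φ : Module.Dual k H) :
    hitLeft (x * y) φ = hitLeft x (hitLeft y φ) := by
  ext z; simp [hitLeft_apply, mul_assoc]

theorem hitRight_mul (x y : H) (φ : Module.Dual k H) :
    hitRight φ (x * y) = hitRight (hitRight φ x) y := by
  ext z; simp [hitRight_apply, mul_assoc]

theorem hitLeft_hitRight (x y : H) (φ : Module.Dual k H) :
    hitLeft x (hitRight φ y) = hitRight (hitLeft x φ) y := by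
  ext z; simp [hitRight_apply, hitLeft_apply, mul_assoc]

theorem hitLeft_one (φ : Module.Dual k H) : hitLeft 1 φ = φ := by
  ext z; simp [hitLeft_apply]

theorem hitRight_one (φ : Module.Dual k H) : hitRight φ 1 = φ := by
  ext z; simp [hitRight_apply]

theorem hitLeft_counit (x : H) :
    hitLeft x (counit : Module.Dual k H) = counit (R := k) x • (counit : Module.Dual k H) := by
  ext z; simp [hitLeft_apply, mul_comm]

theorem hitRight_counit (x : H) :
    hitRight (counit : Module.Dual k H) x = counit (R := k) x • (counit : Module.Dual k H) := by
  ext z; simp [hitRight_apply]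

/-- Multiplicativity of `Δ`, dualized: `H*` is a module algebra under `⇀`. The next theorem is the
analogue for `↼`. -/
theorem hitLeft_dualMul (x : H) (φ ψ : Module.Dual k H) :
    hitLeft x (dualMul φ ψ) = TensorProduct.lift dualMul
      (TensorProduct.map (hitLeft.flip φ) (hitLeft.flip ψ) (comul x)) := by
  ext y
  have h1 : ∀ (p q : H) (s : H ⊗[k] H),
      LinearMap.mul' k k (TensorProduct.map φ ψ (s * (p ⊗ₜ[k] q))) =
        LinearMap.mul' k k (TensorProduct.map (hitLeft p φ) (hitLeft q ψ) s) := by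
    intro p q s
    induction s with
    | zero => simp
    | tmul a b => simp [hitLeft_apply]
    | add a b ha hb => simp only [map_add, add_mul, ha, hb]
  have h2 : ∀ t : H ⊗[k] H, LinearMap.mul' k k (TensorProduct.map φ ψ (comul y * t)) =
      TensorProduct.lift dualMul
        (TensorProduct.map (hitLeft.flip φ) (hitLeft.flip ψ) t) y := by
    intro t
    induction t with
    | zero => simp
    | tmul a b => rw [h1]; rfl
    | add a b ha hb => simp only [map_add, mul_add, ha, hb, LinearMap.add_apply]
  rw [hitLeft_apply, dualMul_apply, Bialgebra.comul_mul, h2]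

theorem hitRight_dualMul (x : H) (φ ψ : Module.Dual k H) :
    hitRight (dualMul φ ψ) x = TensorProduct.lift dualMul
      (TensorProduct.map (hitRight φ) (hitRight ψ) (comul x)) := by
  ext y
  have h1 : ∀ (p q : H) (s : H ⊗[k] H),
      LinearMap.mul' k k (TensorProduct.map φ ψ ((p ⊗ₜ[k] q) * s)) =
        LinearMap.mul' k k (TensorProduct.map (hitRight φ p) (hitRight ψ q) s) := by
    intro p q s
    induction s with
    | zero => simp
    | tmul a b => simp [hitRight_apply]
    | add a b ha hb => simp only [map_add, mul_add, ha, hb]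
  have h2 : ∀ t : H ⊗[k] H, LinearMap.mul' k k (TensorProduct.map φ ψ (t * comul y)) =
      TensorProduct.lift dualMul
        (TensorProduct.map (hitRight φ) (hitRight ψ) t) y := by
    intro t
    induction t with
    | zero => simp
    | tmul a b => rw [h1]; rfl
    | add a b ha hb => simp only [map_add, add_mul, ha, hb, LinearMap.add_apply]
  rw [hitRight_apply, dualMul_apply, Bialgebra.comul_mul, h2]

variable [FiniteDimensional k H]

theorem antipodeInv_mul (x y : H) :
    antipodeInv k H (x * y) = antipodeInv k H y * antipodeInv k H x :=
  (antipode_bijective (k := k) (H := H)).injective <| by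
    simp [antipode_antipodeInv, antipode_mul_antidistrib]

theorem antipodeInv_one : antipodeInv k H (1 : H) = 1 := by
  conv_lhs => rw [← antipode_one (R := k) (A := H), antipodeInv_antipode]

theorem counit_antipodeInv (x : H) : counit (R := k) (antipodeInv k H x) = counit (R := k) x := by
  conv_rhs => rw [← antipode_antipodeInv (k := k) x, counit_antipode]

/-- Evaluate the anti-comultiplicativity of `S` at `S⁻¹(x)` and cancel `S` on both legs. -/
theorem comul_antipodeInv (x : H) :
    comul (R := k) (antipodeInv k H x) =
      TensorProduct.map (antipodeInv k H) (antipodeInv k H)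
        (TensorProduct.comm k H H (comul x)) := by
  have h := LinearMap.congr_fun (comul_antipode_eq (k := k) (H := H)) (antipodeInv k H x)
  simp only [LinearMap.comp_apply, antipode_antipodeInv, LinearEquiv.coe_coe] at h
  have key : ∀ t : H ⊗[k] H, TensorProduct.map (antipodeInv k H) (antipodeInv k H)
      (TensorProduct.comm k H H (TensorProduct.map (antipode k) (antipode k)
        (TensorProduct.comm k H H t))) = t := by
    intro t
    induction t with
    | zero => simp
    | tmul a b => simp [antipodeInv_antipode]
    | add a b ha hb => simp only [map_add, ha, hb]
  rw [h, key]

end DualActions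

/-! ### Multiplication in the double as operators on `H* ⊗ H`. -/

section Operators
variable {k H : Type*} [Field k] [Ring H] [HopfAlgebra k H]

variable (k H) in
/-- The representation `h ↦ (φ ⊗ h' ↦ h ⇀ φ ⊗ h')` of `H` on `H* ⊗ H`. -/
noncomputable def opLeft : H →ₐ[k] Module.End k (Module.Dual k H ⊗[k] H) :=
  AlgHom.ofLinearMap (LinearMap.rTensorHom H ∘ₗ hitLeft)
    (by ext φ h; simp [hitLeft_one])
    (fun x y => by ext φ h; simp [hitLeft_mul])

theorem opLeft_tmul (x h : H) (φ : Module.Dual k H) :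
    opLeft k H x (φ ⊗ₜ h) = hitLeft x φ ⊗ₜ h := rfl

variable (k H) in
/-- The representation `h ↦ (φ ⊗ h' ↦ φ ⊗ h h')` of `H` on `H* ⊗ H`. -/
noncomputable def opMul : H →ₐ[k] Module.End k (Module.Dual k H ⊗[k] H) :=
  AlgHom.ofLinearMap (LinearMap.lTensorHom (Module.Dual k H) ∘ₗ LinearMap.mul k H)
    (by ext φ h; simp)
    (fun x y => by ext φ h; simp [mul_assoc])

theorem opMul_tmul (x h : H) (φ : Module.Dual k H) :
    opMul k H x (φ ⊗ₜ h) = φ ⊗ₜ (x * h) := rfl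

variable (k H) in
/-- The operator `φ' ⊗ h ↦ φ φ' ⊗ h` on `H* ⊗ H`. -/
noncomputable def opDual : Module.Dual k H →ₗ[k] Module.End k (Module.Dual k H ⊗[k] H) :=
  LinearMap.rTensorHom H ∘ₗ dualMul

theorem opDual_tmul (φ ψ : Module.Dual k H) (h : H) :
    opDual k H φ (ψ ⊗ₜ h) = dualMul φ ψ ⊗ₜ h := rfl

theorem opDual_dualMul (φ ψ : Module.Dual k H) :
    opDual k H (dualMul φ ψ) = opDual k H φ * opDual k H ψ := by
  ext χ h; simp [opDual_tmul, isAlgebraStructure_dualMul.assoc]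

theorem opDual_counit : opDual k H counit = 1 := by
  ext χ h; simp [opDual_tmul, isAlgebraStructure_dualMul.one_mul]

theorem opMul_mul_opDual (x : H) (φ : Module.Dual k H) :
    opMul k H x * opDual k H φ = opDual k H φ * opMul k H x := by
  ext χ h; simp [opDual_tmul, opMul_tmul]

theorem opLeft_mul_opDual (x : H) (φ : Module.Dual k H) :
    opLeft k H x * opDual k H φ = LinearMap.mul' k _ (TensorProduct.map
      (opDual k H ∘ₗ hitLeft.flip φ) (opLeft k H).toLinearMap (comul x)) := by
  apply TensorProduct.ext'
  intro ψ h
  have key : ∀ t : H ⊗[k] H, LinearMap.mul' k (Module.End k (Module.Dual k H ⊗[k] H))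
      (TensorProduct.map (opDual k H ∘ₗ hitLeft.flip φ) (opLeft k H).toLinearMap t) (ψ ⊗ₜ h) =
      TensorProduct.lift dualMul
        (TensorProduct.map (hitLeft.flip φ) (hitLeft.flip ψ) t) ⊗ₜ h := by
    intro t
    induction t with
    | zero => simp
    | tmul a b => simp [opLeft_tmul, opDual_tmul]
    | add a b ha hb => simp only [map_add, LinearMap.add_apply, add_tmul, ha, hb]
  rw [key, ← hitLeft_dualMul]
  rfl

variable [FiniteDimensional k H]

variable (k H) in
/-- The representation `h ↦ (φ ⊗ h' ↦ φ ↼ S⁻¹(h) ⊗ h')` of `H` on `H* ⊗ H`. -/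
noncomputable def opRight : H →ₐ[k] Module.End k (Module.Dual k H ⊗[k] H) :=
  AlgHom.ofLinearMap (LinearMap.rTensorHom H ∘ₗ hitRight.flip ∘ₗ antipodeInv k H)
    (by ext φ h; simp [antipodeInv_one, hitRight_one])
    (fun x y => by ext φ h; simp [antipodeInv_mul, hitRight_mul])

theorem opRight_tmul (x h : H) (φ : Module.Dual k H) :
    opRight k H x (φ ⊗ₜ h) = hitRight φ (antipodeInv k H x) ⊗ₜ h := rfl

/-- The legs of `Δ(x)` appear swapped, unlike in `opLeft_mul_opDual`, because `S⁻¹` reverses the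
comultiplication. -/
theorem opRight_mul_opDual (x : H) (φ : Module.Dual k H) :
    opRight k H x * opDual k H φ = LinearMap.mul' k _ (TensorProduct.map
      (opDual k H ∘ₗ hitRight φ ∘ₗ antipodeInv k H) (opRight k H).toLinearMap
        (TensorProduct.comm k H H (comul x))) := by
  apply TensorProduct.ext'
  intro ψ h
  have key : ∀ t : H ⊗[k] H, LinearMap.mul' k (Module.End k (Module.Dual k H ⊗[k] H))
      (TensorProduct.map (opDual k H ∘ₗ hitRight φ ∘ₗ antipodeInv k H)
        (opRight k H).toLinearMap t) (ψ ⊗ₜ h) =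
      TensorProduct.lift dualMul (TensorProduct.map (hitRight φ) (hitRight ψ)
        (TensorProduct.map (antipodeInv k H) (antipodeInv k H) t)) ⊗ₜ h := by
    intro t
    induction t with
    | zero => simp
    | tmul a b => simp [opRight_tmul, opDual_tmul]
    | add a b ha hb => simp only [map_add, LinearMap.add_apply, add_tmul, ha, hb]
  rw [key, ← comul_antipodeInv, ← hitRight_dualMul]
  rfl

variable (k H) in
/-- The representation `x ⊗ y ↦ (φ ⊗ h ↦ φ ↼ S⁻¹(x) ⊗ y h)` of `H ⊗ H` on `H* ⊗ H`. -/
noncomputable def opTensor : H ⊗[k] H →ₐ[k] Module.End k (Module.Dual k H ⊗[k] H) :=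
  Algebra.TensorProduct.lift (opRight k H) (opMul k H) fun x y => by
    rw [commute_iff_eq]; ext φ h; simp [opRight_tmul, opMul_tmul]

theorem opTensor_tmul (x y : H) : opTensor k H (x ⊗ₜ y) = opRight k H x * opMul k H y :=
  Algebra.TensorProduct.lift_tmul _ _ _ _ _

theorem opTensor_tmul_apply (x y h : H) (φ : Module.Dual k H) :
    opTensor k H (x ⊗ₜ y) (φ ⊗ₜ h) = hitRight φ (antipodeInv k H x) ⊗ₜ (y * h) := by
  rw [opTensor_tmul]; rfl

theorem hitTensor_eq_opTensor (φ : Module.Dual k H) (t : H ⊗[k] H) (h : H) :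
    hitTensor φ (t * (1 ⊗ₜ h)) = opTensor k H t (φ ⊗ₜ h) := by
  induction t with
  | zero => simp
  | tmul a b => simp [opTensor_tmul_apply, hitTensor_tmul]
  | add a b ha hb => simp only [map_add, LinearMap.add_apply, add_mul, ha, hb]

theorem hitTensor_eq_opTensor_one (φ : Module.Dual k H) (t : H ⊗[k] H) :
    hitTensor φ t = opTensor k H t (φ ⊗ₜ 1) := by
  rw [← hitTensor_eq_opTensor, ← Algebra.TensorProduct.one_def, mul_one]

theorem commute_opLeft_opTensor (x : H) (t : H ⊗[k] H) :
    Commute (opLeft k H x) (opTensor k H t) := by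
  induction t with
  | zero => simp
  | tmul a b =>
    rw [commute_iff_eq]; ext φ h
    simp [opLeft_tmul, opTensor_tmul_apply, hitLeft_hitRight]
  | add a b ha hb => rw [map_add]; exact ha.add_right hb

variable (k H) in
/-- The representation `h ↦ (φ ⊗ h' ↦ φ ↼ S⁻¹(h_2) ⊗ h_1 h')` of `H` on `H* ⊗ H`. -/
noncomputable def opComulSwap : H →ₐ[k] Module.End k (Module.Dual k H ⊗[k] H) :=
  (opTensor k H).comp
    ((Algebra.TensorProduct.comm k H H).toAlgHom.comp (Bialgebra.comulAlgHom k H))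

theorem opComulSwap_apply (x : H) :
    opComulSwap k H x = opTensor k H (TensorProduct.comm k H H (comul x)) := rfl

variable (k H) in
/-- Left multiplication by `ε ⊗ h` in the Drinfeld double, as a representation of `H` on
`H* ⊗ H`: `φ ⊗ h' ↦ h_1 ⇀ φ ↼ S⁻¹(h_3) ⊗ h_2 h'`. -/
noncomputable def opDouble : H →ₐ[k] Module.End k (Module.Dual k H ⊗[k] H) :=
  (Algebra.TensorProduct.lift (opLeft k H) (opComulSwap k H)
    fun _ _ => commute_opLeft_opTensor _ _).comp (Bialgebra.comulAlgHom k H)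

theorem opDouble_apply (x : H) :
    opDouble k H x = LinearMap.mul' k _
      (TensorProduct.map (opLeft k H).toLinearMap (opComulSwap k H).toLinearMap (comul x)) := by
  change Algebra.TensorProduct.lift (opLeft k H) (opComulSwap k H)
    (fun _ _ => commute_opLeft_opTensor _ _) (comul x) = _
  generalize (comul x : H ⊗[k] H) = t
  induction t with
  | zero => simp
  | tmul a b => exact Algebra.TensorProduct.lift_tmul _ _ _ _ _
  | add a b ha hb => simp only [map_add, ha, hb]

/-- The element `u (h_3 ⊗ h_2) v` acts through the representation `opTensor`, and the action of
`h_1` by `⇀` commutes with it, so it can be moved between `u` and `h_3 ⊗ h_2`. -/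
theorem twistMap_tmul (u v : H ⊗[k] H) (h : H) (φ : Module.Dual k H) :
    twistMap u v (h ⊗ₜ φ) = opTensor k H u (opDouble k H h (opTensor k H v (φ ⊗ₜ 1))) := by
  change TensorProduct.lift ((hitTensor ∘ₗ hitLeft.flip φ).compl₂
        (LinearMap.mulLeft k u ∘ₗ LinearMap.mulRight k v ∘ₗ
          (TensorProduct.comm k H H).toLinearMap)) (comul.lTensor H (comul h)) = _
  rw [opDouble_apply]
  generalize (comul h : H ⊗[k] H) = t
  induction t with
  | zero => simp
  | tmul a b =>
    have := LinearMap.congr_fun (commute_opLeft_opTensor (k := k) a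
      (TensorProduct.comm k H H (comul b) * v)).eq (φ ⊗ₜ 1)
    simp only [map_mul, Module.End.mul_apply, opLeft_tmul] at this
    simp [hitTensor_eq_opTensor_one, opComulSwap_apply, ← this]
  | add a b ha hb => simp only [map_add, LinearMap.add_apply, ha, hb]

/-- `opDouble` only multiplies the `H`-leg from the left. This extends formulas from `φ ⊗ 1` to `φ ⊗
h`. -/
theorem opDouble_lTensor_mulRight (x h : H) (y : Module.Dual k H ⊗[k] H) :
    opDouble k H x ((LinearMap.mulRight k h).lTensor _ y) =
      (LinearMap.mulRight k h).lTensor _ (opDouble k H x y) := by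
  have h1 : ∀ t : H ⊗[k] H, opTensor k H t * (LinearMap.mulRight k h).lTensor _ =
      (LinearMap.mulRight k h).lTensor _ * opTensor k H t := by
    intro t
    induction t with
    | zero => simp
    | tmul a b => ext φ h; simp [opTensor_tmul_apply, mul_assoc]
    | add a b ha hb => rw [map_add, mul_add, add_mul, ha, hb]
  have h2 : ∀ a, opLeft k H a * (LinearMap.mulRight k h).lTensor _ =
      (LinearMap.mulRight k h).lTensor _ * opLeft k H a := by
    intro a; ext φ h; simp [opLeft_tmul]
  rw [← Module.End.mul_apply, ← Module.End.mul_apply, opDouble_apply]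
  congr 1
  generalize (comul x : H ⊗[k] H) = t
  induction t with
  | zero => simp
  | tmul a b =>
    simp only [TensorProduct.map_tmul, LinearMap.mul'_apply, AlgHom.toLinearMap_apply,
      opComulSwap_apply]
    rw [mul_assoc, h1, ← mul_assoc, h2, mul_assoc]
  | add a b ha hb => rw [map_add, map_add, mul_add, add_mul, ha, hb]

theorem doubleMul_tmul (φ : Module.Dual k H) (h : H) (y : Module.Dual k H ⊗[k] H) :
    doubleMul k H (φ ⊗ₜ h) y = opDual k H φ (opDouble k H h y) := by
  induction y with
  | zero => simp
  | tmul ψ h' =>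
    have h1 : (LinearMap.mulRight k h').lTensor (Module.Dual k H) (ψ ⊗ₜ 1) = ψ ⊗ₜ h' := by simp
    rw [doubleMul, twistedMul_tmul, twistMap_tmul, map_one, Module.End.one_apply,
      Module.End.one_apply, ← h1, opDouble_lTensor_mulRight]
    generalize opDouble k H h (ψ ⊗ₜ 1) = t
    induction t with
    | zero => simp
    | tmul a b => simp [opDual_tmul]
    | add a b ha hb => simp only [map_add, ha, hb]
  | add a b ha hb => simp only [map_add, ha, hb]

theorem opTensor_counit (t : H ⊗[k] H) :
    opTensor k H t (counit ⊗ₜ 1) = counit ⊗ₜ TensorProduct.lid k H (counit.rTensor H t) := by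
  induction t with
  | zero => simp
  | tmul a b => simp [opTensor_tmul_apply, hitRight_counit, counit_antipodeInv, smul_tmul]
  | add a b ha hb => simp only [map_add, LinearMap.add_apply, tmul_add, ha, hb]

theorem opDouble_counit (h : H) :
    opDouble k H h (counit ⊗ₜ 1) = (counit : Module.Dual k H) ⊗ₜ h := by
  have h1 : ∀ b : H, opComulSwap k H b (counit ⊗ₜ 1) = (counit : Module.Dual k H) ⊗ₜ b := by
    intro b
    rw [opComulSwap_apply, opTensor_counit]
    congr 1
    have := Coalgebra.lTensor_counit_comul (R := k) b
    have h2 : ∀ t : H ⊗[k] H, TensorProduct.lid k H (counit.rTensor H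
        (TensorProduct.comm k H H t)) = TensorProduct.rid k H (counit.lTensor H t) := by
      intro t
      induction t with
      | zero => simp
      | tmul a b => simp
      | add a b ha hb => simp only [map_add, ha, hb]
    rw [h2, this]; simp
  rw [opDouble_apply]
  have h3 : ∀ t : H ⊗[k] H, LinearMap.mul' k (Module.End k (Module.Dual k H ⊗[k] H))
      (TensorProduct.map (opLeft k H).toLinearMap (opComulSwap k H).toLinearMap t) (counit ⊗ₜ 1) =
      (counit : Module.Dual k H) ⊗ₜ TensorProduct.lid k H (counit.rTensor H t) := by
    intro t
    induction t with
    | zero => simp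
    | tmul a b => simp [h1, opLeft_tmul, hitLeft_counit, smul_tmul]
    | add a b ha hb => simp only [map_add, LinearMap.add_apply, tmul_add, ha, hb]
  rw [h3, Coalgebra.rTensor_counit_comul]
  simp

end Operators

/-! ### Associativity of the Drinfeld double. -/

section DoubleAssoc
variable {k H : Type*} [Field k] [Ring H] [HopfAlgebra k H]

/-- Both sides are `h_1 ⊗ ((h_2 ⊗ h_3) ⊗ h_4)`. The outer legs will act on a functional, and the
inner pair forms an `opDouble`. -/
theorem coassoc_four_fold (h : H) :
    (TensorProduct.assoc k H H H).symm.toLinearMap.lTensor H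
      (TensorProduct.assoc k H H (H ⊗[k] H) (TensorProduct.map comul comul (comul (R := k) h))) =
    (comul.rTensor H ∘ₗ comul).lTensor H (comul (R := k) h) := by
  have h1 : ∀ t : H ⊗[k] H, (TensorProduct.assoc k H H H).symm.toLinearMap.lTensor H
      (TensorProduct.assoc k H H (H ⊗[k] H) (TensorProduct.map comul comul t)) =
      ((TensorProduct.assoc k H H H).symm.toLinearMap ∘ₗ comul.lTensor H).lTensor H
        (TensorProduct.assoc k H H H (comul.rTensor H t)) := by
    intro t
    induction t with
    | zero => simp
    | tmul a b =>
      simp only [TensorProduct.map_tmul, LinearMap.rTensor_tmul]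
      generalize (comul a : H ⊗[k] H) = s
      induction s with
      | zero => simp
      | tmul c d => simp
      | add c d hc hd => simp only [map_add, add_tmul, hc, hd]
    | add a b ha hb => simp only [map_add, ha, hb]
  rw [h1, Coalgebra.coassoc_apply, ← LinearMap.comp_apply, ← LinearMap.lTensor_comp,
    LinearMap.comp_assoc, Coalgebra.coassoc_symm]

variable [FiniteDimensional k H]

theorem opComulSwap_mul_opDual (h : H) (ψ : Module.Dual k H) :
    opComulSwap k H h * opDual k H ψ = LinearMap.mul' k _ (TensorProduct.map
      (opDual k H ∘ₗ hitRight ψ ∘ₗ antipodeInv k H) (opComulSwap k H).toLinearMap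
        (TensorProduct.comm k H H (comul h))) := by
  -- `F` sends `x ⊗ y ⊗ z` to `opDual (ψ ↼ S⁻¹(z)) * opTensor (y ⊗ x)`. Both sides are `F` of an
  -- iterated coproduct of `h`, in the two bracketings.
  let F : H ⊗[k] (H ⊗[k] H) →ₗ[k] Module.End k (Module.Dual k H ⊗[k] H) :=
    LinearMap.mul' k _ ∘ₗ TensorProduct.map (opDual k H ∘ₗ hitRight ψ ∘ₗ antipodeInv k H)
      (opTensor k H).toLinearMap ∘ₗ (TensorProduct.assoc k H H H).toLinearMap ∘ₗ
      (TensorProduct.comm k H H).toLinearMap.rTensor H ∘ₗ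
      (TensorProduct.comm k H (H ⊗[k] H)).toLinearMap
  have h1 : ∀ t : H ⊗[k] H, opTensor k H (TensorProduct.comm k H H t) * opDual k H ψ =
      F (comul.lTensor H t) := by
    intro t
    induction t with
    | zero => simp
    | tmul a b =>
      rw [TensorProduct.comm_tmul, opTensor_tmul, mul_assoc, opMul_mul_opDual, ← mul_assoc,
        opRight_mul_opDual, LinearMap.lTensor_tmul]
      generalize (comul b : H ⊗[k] H) = s
      induction s with
      | zero => simp
      | tmul c d => simp [F, opTensor_tmul, mul_assoc]
      | add c d hc hd => simp only [map_add, tmul_add, add_mul, hc, hd]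
    | add a b ha hb => simp only [map_add, add_mul, ha, hb]
  have h2 : ∀ t : H ⊗[k] H, LinearMap.mul' k (Module.End k (Module.Dual k H ⊗[k] H))
      (TensorProduct.map
      (opDual k H ∘ₗ hitRight ψ ∘ₗ antipodeInv k H) (opComulSwap k H).toLinearMap
        (TensorProduct.comm k H H t)) =
      F (TensorProduct.assoc k H H H (comul.rTensor H t)) := by
    intro t
    induction t with
    | zero => simp
    | tmul a b =>
      simp only [TensorProduct.comm_tmul, TensorProduct.map_tmul, LinearMap.mul'_apply,
        AlgHom.toLinearMap_apply, LinearMap.rTensor_tmul, opComulSwap_apply]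
      generalize (comul a : H ⊗[k] H) = s
      induction s with
      | zero => simp
      | tmul c d => simp [F]
      | add c d hc hd => simp only [map_add, add_tmul, mul_add, hc, hd]
    | add a b ha hb => simp only [map_add, ha, hb]
  rw [opComulSwap_apply, h1, h2, Coalgebra.coassoc_apply]

variable (k H) in
/-- `(φ, x ⊗ y) ↦ x ⇀ φ ↼ S⁻¹(y)`. -/
noncomputable def hitBoth (φ : Module.Dual k H) : H ⊗[k] H →ₗ[k] Module.Dual k H :=
  TensorProduct.lift ((hitRight.compl₂ (antipodeInv k H)) ∘ₗ hitLeft.flip φ)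

theorem hitBoth_tmul (φ : Module.Dual k H) (x y : H) :
    hitBoth k H φ (x ⊗ₜ y) = hitRight (hitLeft x φ) (antipodeInv k H y) := rfl

/-- For `T : M → End(H* ⊗ H)`, the map `x ⊗ (m ⊗ y) ↦ (x ⇀ ψ ↼ S⁻¹(y)) T(m)`. -/
noncomputable def outerTwist {M : Type*} [AddCommGroup M] [Module k M] (ψ : Module.Dual k H)
    (T : M →ₗ[k] Module.End k (Module.Dual k H ⊗[k] H)) :
    H ⊗[k] (M ⊗[k] H) →ₗ[k] Module.End k (Module.Dual k H ⊗[k] H) :=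
  LinearMap.mul' k _ ∘ₗ TensorProduct.map (opDual k H ∘ₗ hitBoth k H ψ) T ∘ₗ
    (TensorProduct.assoc k H H M).symm.toLinearMap ∘ₗ
    (TensorProduct.comm k M H).toLinearMap.lTensor H

theorem outerTwist_tmul {M : Type*} [AddCommGroup M] [Module k M] (ψ : Module.Dual k H)
    (T : M →ₗ[k] Module.End k (Module.Dual k H ⊗[k] H)) (x y : H) (m : M) :
    outerTwist ψ T (x ⊗ₜ (m ⊗ₜ y)) =
      opDual k H (hitRight (hitLeft x ψ) (antipodeInv k H y)) * T m := rfl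

/-- The commutation rule of the double, `h ψ = (h_1 ⇀ ψ ↼ S⁻¹(h_3)) h_2`. Moving `ψ` left past the
swapped coproduct and then past `⇀` splits off the last and the first leg of `h`. -/
theorem opDouble_mul_opDual (h : H) (ψ : Module.Dual k H) :
    opDouble k H h * opDual k H ψ =
      outerTwist ψ (opDouble k H).toLinearMap (comul.lTensor H (comul h)) := by
  let P : H ⊗[k] H →ₗ[k] Module.End k (Module.Dual k H ⊗[k] H) :=
    LinearMap.mul' k _ ∘ₗ TensorProduct.map (opLeft k H).toLinearMap (opComulSwap k H).toLinearMap
  -- Unfolding the coproduct inside `opDouble` makes both sides values of `outerTwist ψ P` on four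
  -- legs.
  have h0 : ∀ t : H ⊗[k] (H ⊗[k] H), outerTwist ψ (opDouble k H).toLinearMap t =
      outerTwist ψ P ((comul.rTensor H).lTensor H t) := by
    have : outerTwist ψ (opDouble k H).toLinearMap =
        outerTwist ψ P ∘ₗ (comul.rTensor H).lTensor H := by
      apply TensorProduct.ext'
      intro x s
      induction s with
      | zero => simp
      | tmul y z => simp [outerTwist_tmul, P, opDouble_apply]
      | add y z hy hz => simp only [map_add, tmul_add, hy, hz]
    exact fun t => LinearMap.congr_fun this t
  have h1 : ∀ t : H ⊗[k] H, P t * opDual k H ψ = outerTwist ψ P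
      ((TensorProduct.assoc k H H H).symm.toLinearMap.lTensor H
        (TensorProduct.assoc k H H (H ⊗[k] H) (TensorProduct.map comul comul t))) := by
    intro t
    induction t with
    | zero => simp
    | tmul a b =>
      have e : P (a ⊗ₜ b) = opLeft k H a * opComulSwap k H b := rfl
      rw [e, mul_assoc, opComulSwap_mul_opDual, TensorProduct.map_tmul]
      generalize (comul b : H ⊗[k] H) = s
      induction s with
      | zero => simp
      | tmul c d =>
        simp only [TensorProduct.comm_tmul, TensorProduct.map_tmul, LinearMap.mul'_apply,
          LinearMap.comp_apply, AlgHom.toLinearMap_apply]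
        rw [← mul_assoc, opLeft_mul_opDual]
        generalize (comul a : H ⊗[k] H) = s
        induction s with
        | zero => simp
        | tmul x y => simp [outerTwist_tmul, P, mul_assoc, hitLeft_hitRight]
        | add x y hx hy => simp only [map_add, add_tmul, add_mul, hx, hy]
      | add c d hc hd => simp only [map_add, tmul_add, mul_add, hc, hd]
    | add a b ha hb => simp only [map_add, add_mul, ha, hb]
  have e : opDouble k H h = P (comul h) := opDouble_apply h
  rw [h0, e, h1, coassoc_four_fold, LinearMap.lTensor_comp]
  rfl

/-- Associativity for a left factor `ε ⊗ h`. On `X = ψ ⊗ h'` it is the commutation rule followed by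
multiplicativity of `opDouble`. -/
theorem doubleMul_opDouble (h : H) (X : Module.Dual k H ⊗[k] H) :
    doubleMul k H (opDouble k H h X) = opDouble k H h * doubleMul k H X := by
  induction X with
  | zero => simp
  | add a b ha hb => simp only [map_add, mul_add, ha, hb]
  | tmul ψ h' =>
    have e : doubleMul k H (ψ ⊗ₜ h') = opDual k H ψ * opDouble k H h' :=
      LinearMap.ext (doubleMul_tmul ψ h')
    have h1 : ∀ t : H ⊗[k] H, doubleMul k H (LinearMap.mul' k
        (Module.End k (Module.Dual k H ⊗[k] H)) (TensorProduct.map (opLeft k H).toLinearMap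
          (opComulSwap k H).toLinearMap t) (ψ ⊗ₜ h')) =
        outerTwist ψ (opDouble k H).toLinearMap (comul.lTensor H t) * opDouble k H h' := by
      intro t
      induction t with
      | zero => simp
      | add a b ha hb => simp only [map_add, LinearMap.add_apply, add_mul, ha, hb]
      | tmul x y =>
        simp only [TensorProduct.map_tmul, LinearMap.mul'_apply, AlgHom.toLinearMap_apply,
          LinearMap.lTensor_tmul, Module.End.mul_apply, opComulSwap_apply]
        generalize (comul y : H ⊗[k] H) = s
        induction s with
        | zero => simp
        | add a b ha hb => simp only [map_add, LinearMap.add_apply, tmul_add, add_mul, ha, hb]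
        | tmul z w =>
          rw [TensorProduct.comm_tmul, opTensor_tmul_apply, opLeft_tmul, hitLeft_hitRight,
            outerTwist_tmul, AlgHom.toLinearMap_apply, mul_assoc, ← map_mul]
          exact LinearMap.ext (doubleMul_tmul _ _)
    rw [e, ← mul_assoc, opDouble_mul_opDual, ← h1, opDouble_apply]

theorem isAlgebraStructure_doubleMul :
    IsAlgebraStructure (doubleMul k H) ((counit : Module.Dual k H) ⊗ₜ[k] (1 : H)) where
  assoc X Y Z := by
    induction X with
    | zero => simp
    | add a b ha hb => simp only [map_add, LinearMap.add_apply, ha, hb]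
    | tmul φ h =>
      have h1 : ∀ W, doubleMul k H (opDual k H φ W) = opDual k H φ * doubleMul k H W := by
        intro W
        induction W with
        | zero => simp
        | add a b ha hb => simp only [map_add, mul_add, ha, hb]
        | tmul ψ h' =>
          refine LinearMap.ext fun V => ?_
          rw [opDual_tmul, doubleMul_tmul, opDual_dualMul, Module.End.mul_apply,
            Module.End.mul_apply, doubleMul_tmul]
      rw [doubleMul_tmul, doubleMul_tmul, h1, doubleMul_opDouble]
      rfl
  one_mul X := by rw [doubleMul_tmul, map_one, opDual_counit]; rfl
  mul_one X := by
    induction X with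
    | zero => simp
    | add a b ha hb => simp only [map_add, LinearMap.add_apply, ha, hb]
    | tmul φ h =>
      rw [doubleMul_tmul, opDouble_counit, opDual_tmul, isAlgebraStructure_dualMul.mul_one]

end DoubleAssoc

/-! ### Consequences of the conditions on `r`. -/

section SQT
variable {k H : Type*} [Field k] [Ring H] [HopfAlgebra k H]

/-- Applying `ε ⊗ ε ⊗ id` to the first condition shows that `ε(r^1) r^2` is idempotent. It is also a
unit, as the image of `r` under an algebra map, hence equals `1`. -/
theorem SatisfiesSQT.counit_rTensor {r : (H ⊗[k] H)ˣ} (hr : SatisfiesSQT (r : H ⊗[k] H)) :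
    TensorProduct.lid k H (counit.rTensor H (r : H ⊗[k] H)) = 1 := by
  let q : H ⊗[k] H →ₐ[k] H := (Algebra.TensorProduct.lid k H).toAlgHom.comp
    (Algebra.TensorProduct.map (Bialgebra.counitAlgHom k H) (AlgHom.id k H))
  let q₃ : H ⊗[k] (H ⊗[k] H) →ₐ[k] H := (Algebra.TensorProduct.lid k H).toAlgHom.comp
    (Algebra.TensorProduct.map (Bialgebra.counitAlgHom k H) q)
  have e1 : ∀ t : H ⊗[k] H, q₃ (TensorProduct.assoc k H H H (comul.rTensor H t)) = q t := by
    intro t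
    induction t with
    | zero => simp
    | add a b ha hb => simp only [map_add, ha, hb]
    | tmul x y =>
      have h1 : ∀ s : H ⊗[k] H, q₃ (TensorProduct.assoc k H H H (s ⊗ₜ y)) =
          q ((TensorProduct.lid k H (counit.rTensor H s)) ⊗ₜ y) := by
        intro s
        induction s with
        | zero => simp
        | add a b ha hb => simp only [map_add, add_tmul, ha, hb]
        | tmul a b => simp [q₃, q, smul_smul, mul_comm]
      rw [LinearMap.rTensor_tmul, h1, Coalgebra.rTensor_counit_comul]
      simp
  have e2 : ∀ t : H ⊗[k] H, q₃ (leg13 t) = q t := by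
    intro t
    induction t with
    | zero => simp [leg13]
    | add a b ha hb => simp only [leg13, map_add] at ha hb ⊢; rw [ha, hb]
    | tmul x y => simp [q₃, q, leg13]
  have e3 : ∀ t : H ⊗[k] H, q₃ (leg23 t) = q t := by
    intro t; simp [q₃, leg23]
  have h := congrArg q₃ hr.sqt1
  rw [e1, map_mul, e2, e3] at h
  have hq : IsUnit (q r) := r.isUnit.map q
  have h1 : q r = 1 := by
    have := hq.mul_left_cancel ((mul_one (q r)).trans h)
    exact this.symm
  have h2 : ∀ t : H ⊗[k] H, TensorProduct.lid k H (counit.rTensor H t) = q t := by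
    intro t
    induction t with
    | zero => simp
    | add a b ha hb => simp only [map_add, ha, hb]
    | tmul x y => simp [q]
  rw [h2, h1]

section FourLegs
variable (a b c : H ⊗[k] (H ⊗[k] (H ⊗[k] H)))

theorem fourLegs_mul_assoc : a * b * c = a * (b * c) := mul_assoc a b c

theorem fourLegs_add_mul : (a + b) * c = a * c + b * c :=
  (LinearMap.mulRight k c).map_add a b

theorem fourLegs_mul_add : a * (b + c) = a * b + a * c :=
  (LinearMap.mul k _ a).map_add b c

theorem fourLegs_zero_mul : 0 * a = 0 := zero_mul a

theorem fourLegs_mul_zero : a * 0 = 0 := mul_zero a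

end FourLegs

/-- `x ⊗ y ⊗ z ↦ x ⊗ y_1 ⊗ y_2 ⊗ z`. -/
noncomputable def comulMiddle : H ⊗[k] (H ⊗[k] H) →ₐ[k] H ⊗[k] (H ⊗[k] (H ⊗[k] H)) :=
  Algebra.TensorProduct.map (AlgHom.id k H)
    ((Algebra.TensorProduct.assoc k k k H H H).toAlgHom.comp
      (Algebra.TensorProduct.map (Bialgebra.comulAlgHom k H) (AlgHom.id k H)))

/-- `x ⊗ y ⊗ z ↦ x ⊗ y ⊗ f(z)`. -/
noncomputable def mapLast (f : H →ₐ[k] H ⊗[k] H) :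
    H ⊗[k] (H ⊗[k] H) →ₐ[k] H ⊗[k] (H ⊗[k] (H ⊗[k] H)) :=
  Algebra.TensorProduct.map (AlgHom.id k H) (Algebra.TensorProduct.map (AlgHom.id k H) f)

/-- `x ⊗ y ⊗ z ↦ x ⊗ 1 ⊗ y ⊗ z`. -/
noncomputable def skipSecond : H ⊗[k] (H ⊗[k] H) →ₐ[k] H ⊗[k] (H ⊗[k] (H ⊗[k] H)) :=
  Algebra.TensorProduct.map (AlgHom.id k H) Algebra.TensorProduct.includeRight

/-- `x ⊗ y ⊗ z ↦ y ⊗ 1 ⊗ x ⊗ z`. -/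
noncomputable def skipSecondSwap : H ⊗[k] (H ⊗[k] H) →ₐ[k] H ⊗[k] (H ⊗[k] (H ⊗[k] H)) :=
  skipSecond.comp (Algebra.TensorProduct.leftComm k H H H).toAlgHom

variable (k H) in
/-- `Δᶜᵒᵖ` as an algebra map. -/
noncomputable def comulSwap : H →ₐ[k] H ⊗[k] H :=
  (Algebra.TensorProduct.comm k H H).toAlgHom.comp (Bialgebra.comulAlgHom k H)

theorem comulSwap_apply (x : H) : comulSwap k H x = TensorProduct.comm k H H (comul x) := rfl

/-- The four-legged identity behind the multiplicativity of `φ ↦ φ ↼ S⁻¹(r^1) ⊗ r^2`. -/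
theorem SatisfiesSQT.four_legs {r : H ⊗[k] H} (hr : SatisfiesSQT r) :
    mapLast (comulSwap k H) (comul.lTensor H r) * (1 ⊗ₜ (1 ⊗ₜ r)) =
      skipSecondSwap (TensorProduct.assoc k H H H (comul.rTensor H r)) *
        mapLast Algebra.TensorProduct.includeLeft (comul.lTensor H r) := by
  have s1 : ∀ t : H ⊗[k] H, skipSecondSwap (leg13 t) = 1 ⊗ₜ (1 ⊗ₜ t) := by
    intro t
    induction t with
    | zero => simp [leg13]
    | add a b ha hb => simp only [leg13, map_add, tmul_add] at ha hb ⊢; rw [ha, hb]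
    | tmul x y => simp [skipSecondSwap, skipSecond, leg13]
  have s2 : ∀ t : H ⊗[k] H, skipSecondSwap (leg23 t) = comulMiddle (leg13 t) := by
    intro t
    induction t with
    | zero => simp [leg13, leg23]
    | add a b ha hb => simp only [leg13, leg23, map_add, tmul_add] at ha hb ⊢; rw [ha, hb]
    | tmul x y =>
      simp [skipSecondSwap, skipSecond, leg13, leg23, comulMiddle, Algebra.TensorProduct.one_def]
  have s3 : ∀ t : H ⊗[k] H, mapLast Algebra.TensorProduct.includeLeft (comul.lTensor H t) =
      comulMiddle (leg12 t) := by
    intro t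
    induction t with
    | zero => simp [leg12]
    | add a b ha hb => simp only [leg12, map_add] at ha hb ⊢; rw [ha, hb]
    | tmul x y =>
      simp only [leg12, mapLast, comulMiddle, LinearMap.lTensor_tmul,
        Algebra.TensorProduct.map_tmul, LinearMap.flip_apply, TensorProduct.mk_apply,
        AlgHom.comp_apply, Bialgebra.comulAlgHom_apply]
      congr 1
      generalize (comul y : H ⊗[k] H) = s
      induction s with
      | zero => simp
      | tmul a b => simp
      | add a b ha hb => rw [map_add, add_tmul, map_add, ha, hb]
  have s4 : ∀ t : H ⊗[k] H, comulMiddle (comul.lTensor H t) =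
      mapLast (Bialgebra.comulAlgHom k H) (comul.lTensor H t) := by
    intro t
    induction t with
    | zero => simp
    | add a b ha hb => simp only [map_add, ha, hb]
    | tmul x y =>
      simp only [LinearMap.lTensor_tmul, mapLast, comulMiddle, Algebra.TensorProduct.map_tmul]
      congr 1
      exact Coalgebra.coassoc_apply y
  have s5 : ∀ t : H ⊗[k] H, mapLast (comulSwap k H) (leg13 t) = skipSecond
      (((TensorProduct.comm k H H).toLinearMap ∘ₗ comul).lTensor H t) := by
    intro t
    induction t with
    | zero => simp [leg13]
    | add a b ha hb => simp only [leg13, map_add] at ha hb ⊢; rw [ha, hb]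
    | tmul x y => simp [leg13, mapLast, skipSecond, comulSwap_apply]
  have s6 : ∀ t : H ⊗[k] H, mapLast (Bialgebra.comulAlgHom k H) (leg13 t) = skipSecond
      (comul.lTensor H t) := by
    intro t
    induction t with
    | zero => simp [leg13]
    | add a b ha hb => simp only [leg13, map_add] at ha hb ⊢; rw [ha, hb]
    | tmul x y => simp [leg13, mapLast, skipSecond]
  have s7 : ∀ (f : H →ₐ[k] H ⊗[k] H) (t : H ⊗[k] H), mapLast f (leg12 t) =
      ((TensorProduct.mk k H (H ⊗[k] H)).flip 1).lTensor H t := by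
    intro f t
    induction t with
    | zero => simp [leg12]
    | add a b ha hb => simp only [leg12, map_add] at ha hb ⊢; rw [ha, hb]
    | tmul x y => simp [leg12, mapLast]
  -- Elements supported on legs 1, 2 commute with those on legs 3, 4.
  have s8 : ∀ s t : H ⊗[k] H,
      ((TensorProduct.mk k H (H ⊗[k] H)).flip 1).lTensor H s * ((1 : H) ⊗ₜ[k] ((1 : H) ⊗ₜ[k] t)) =
        ((1 : H) ⊗ₜ[k] ((1 : H) ⊗ₜ[k] t)) *
          ((TensorProduct.mk k H (H ⊗[k] H)).flip 1).lTensor H s := by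
    intro s t
    induction s with
    | zero => simp [fourLegs_zero_mul, fourLegs_mul_zero]
    | add a b ha hb => rw [map_add, fourLegs_add_mul, fourLegs_mul_add, ha, hb]
    | tmul x y => simp
  have s9 : skipSecond (leg23 r) = (1 : H) ⊗ₜ[k] ((1 : H) ⊗ₜ[k] r) := by
    simp [skipSecond, leg23]
  calc mapLast (comulSwap k H) (comul.lTensor H r) * ((1 : H) ⊗ₜ[k] ((1 : H) ⊗ₜ[k] r))
    -- Split by the second condition, then move `r_12` past `r_34`.
    _ = mapLast (comulSwap k H) (leg13 r) * ((1 : H) ⊗ₜ[k] ((1 : H) ⊗ₜ[k] r)) *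
          mapLast (Bialgebra.comulAlgHom k H) (leg12 r) := by
      rw [hr.sqt2, map_mul, fourLegs_mul_assoc, s7, s8, ← fourLegs_mul_assoc, s7]
    -- The third condition, on legs 1, 3, 4, moves `r_34` to the front and turns `Δᶜᵒᵖ` into `Δ`.
    -- The second condition and coassociativity then give `r_34 (r^1 ⊗ r^2_1 ⊗ r^2_2 ⊗ r^2_3)`.
    _ = ((1 : H) ⊗ₜ[k] ((1 : H) ⊗ₜ[k] r)) * comulMiddle (comul.lTensor H r) := by
      rw [s5, ← s9, ← map_mul, hr.sqt3, map_mul, ← s6, fourLegs_mul_assoc, ← map_mul, ← hr.sqt2, s4]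
    -- By the first condition the swapped factor on the right-hand side is `r_34 r_14`. The second
    -- condition, under `comulMiddle`, absorbs `r_14` and the last factor.
    _ = _ := by
      rw [hr.sqt1, s3, map_mul, s1, s2, fourLegs_mul_assoc, ← map_mul, ← hr.sqt2]

/-! ### The factorization of the double determined by `r`. -/

variable [FiniteDimensional k H]

/-- `x ⊗ y ⊗ z ⊗ w ↦ (φ ↼ S⁻¹(x)) (y ⇀ ψ ↼ S⁻¹(z)) ⊗ w`. -/
noncomputable def pairFourLegs (φ ψ : Module.Dual k H) :
    H ⊗[k] (H ⊗[k] (H ⊗[k] H)) →ₗ[k] Module.Dual k H ⊗[k] H :=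
  TensorProduct.lift ((opDual k H ∘ₗ hitRight φ ∘ₗ antipodeInv k H).compl₂
    (TensorProduct.lift (hitTensor ∘ₗ hitLeft.flip ψ)))

theorem pairFourLegs_tmul (φ ψ : Module.Dual k H) (x y : H) (t : H ⊗[k] H) :
    pairFourLegs φ ψ (x ⊗ₜ (y ⊗ₜ t)) =
      opDual k H (hitRight φ (antipodeInv k H x)) (hitTensor (hitLeft y ψ) t) := rfl

/-- With `hitTensor_starMul`, this writes both sides of `f(φ) f(ψ) = f(φ * ψ)` as `pairFourLegs φ ψ`
of a four-legged element. Keeping `s` and `t` independent makes the formulas bilinear, so pure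
tensors suffice. -/
theorem doubleMul_hitTensor (φ ψ : Module.Dual k H) (s t : H ⊗[k] H) :
    doubleMul k H (hitTensor φ s) (hitTensor ψ t) =
      pairFourLegs φ ψ (mapLast (comulSwap k H) (comul.lTensor H s) * (1 ⊗ₜ (1 ⊗ₜ t))) := by
  induction s with
  | zero => simp [fourLegs_zero_mul]
  | add a b ha hb => simp only [map_add, LinearMap.add_apply, fourLegs_add_mul, ha, hb]
  | tmul x y =>
    rw [hitTensor_tmul, doubleMul_tmul, opDouble_apply, LinearMap.lTensor_tmul]
    generalize (comul y : H ⊗[k] H) = s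
    induction s with
    | zero => simp [fourLegs_zero_mul]
    | add a b ha hb => simp only [map_add, LinearMap.add_apply, tmul_add, fourLegs_add_mul, ha, hb]
    | tmul a b =>
      have := LinearMap.congr_fun (commute_opLeft_opTensor (k := k) a
        (TensorProduct.comm k H H (comul b) * t)).eq (ψ ⊗ₜ 1)
      simp only [map_mul, Module.End.mul_apply, opLeft_tmul] at this
      simp [mapLast, pairFourLegs_tmul, hitTensor_eq_opTensor_one, opComulSwap_apply,
        comulSwap_apply, this]

/-- Acting by `S⁻¹(t^1)` on a convolution product puts `t^1_2` on the first factor and `t^1_1` on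
the second, whence `skipSecondSwap`. -/
theorem hitTensor_starMul (φ ψ : Module.Dual k H) (s t : H ⊗[k] H) :
    hitTensor (starMul s φ ψ) t = pairFourLegs φ ψ
      (skipSecondSwap (TensorProduct.assoc k H H H (comul.rTensor H t)) *
        mapLast Algebra.TensorProduct.includeLeft (comul.lTensor H s)) := by
  change hitTensor (TensorProduct.lift dualMul
      (TensorProduct.map (hitRight φ ∘ₗ antipodeInv k H) (dotAction.flip ψ) s)) t = _
  induction s with
  | zero => simp [fourLegs_mul_zero]
  | add a b ha hb => simp only [map_add, LinearMap.add_apply, fourLegs_mul_add, ha, hb]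
  | tmul x y =>
    simp only [TensorProduct.map_tmul, TensorProduct.lift.tmul, LinearMap.comp_apply,
      LinearMap.flip_apply, LinearMap.lTensor_tmul]
    have e : dotAction y ψ = hitBoth k H ψ (comul y) := rfl
    rw [e]
    generalize (comul y : H ⊗[k] H) = s
    induction s with
    | zero => simp [fourLegs_mul_zero]
    | add a b ha hb => simp only [map_add, LinearMap.add_apply, tmul_add, fourLegs_mul_add, ha, hb]
    | tmul a b =>
      induction t with
      | zero => simp [fourLegs_zero_mul]
      | add c d hc hd => simp only [map_add, fourLegs_add_mul, hc, hd]
      | tmul z w =>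
        rw [hitBoth_tmul, hitTensor_tmul, hitRight_dualMul, comul_antipodeInv,
          LinearMap.rTensor_tmul]
        generalize (comul z : H ⊗[k] H) = s
        induction s with
        | zero => simp [fourLegs_zero_mul]
        | add c d hc hd => simp only [map_add, add_tmul, fourLegs_add_mul, hc, hd]
        | tmul c d =>
          simp [skipSecondSwap, skipSecond, mapLast, pairFourLegs_tmul, hitTensor_tmul,
            opDual_tmul, antipodeInv_mul, hitRight_mul]

/-- The linear automorphism `φ ⊗ h ↦ φ ↼ S⁻¹(r^1) ⊗ r^2 h` of `H* ⊗ H`. -/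
noncomputable def tensorEquiv (r : (H ⊗[k] H)ˣ) :
    (Module.Dual k H ⊗[k] H) ≃ₗ[k] (Module.Dual k H ⊗[k] H) :=
  LinearMap.GeneralLinearGroup.toLinearEquiv (Units.map (opTensor k H).toMonoidHom r)

theorem tensorEquiv_apply (r : (H ⊗[k] H)ˣ) (x : Module.Dual k H ⊗[k] H) :
    tensorEquiv r x = opTensor k H (r : H ⊗[k] H) x := rfl

theorem SatisfiesSQT.isFactorization {r : (H ⊗[k] H)ˣ} (hr : SatisfiesSQT (r : H ⊗[k] H)) :
    IsFactorization (starMul (r : H ⊗[k] H)) (counit : Module.Dual k H) (LinearMap.mul k H) 1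
      (doubleMul k H) ((counit : Module.Dual k H) ⊗ₜ[k] (1 : H))
      (twistMap ((r⁻¹ : (H ⊗[k] H)ˣ) : H ⊗[k] H) (r : H ⊗[k] H))
      (hitTensor.flip (r : H ⊗[k] H)) (TensorProduct.mk k (Module.Dual k H) H counit)
      (tensorEquiv r) where
  map_mulA φ ψ := by
    simp only [LinearMap.flip_apply]
    rw [doubleMul_hitTensor, hr.four_legs, hitTensor_starMul]
  map_oneA := by
    rw [LinearMap.flip_apply, hitTensor_eq_opTensor_one, opTensor_counit, hr.counit_rTensor]
  map_mulB h h' := by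
    simp only [TensorProduct.mk_apply, LinearMap.mul_apply', doubleMul_tmul, opDual_counit]
    -- Since `ε ⊗ h` is `opDouble h` applied to the unit, `j` is multiplicative because `opDouble`
    -- is a representation.
    rw [Module.End.one_apply, ← opDouble_counit h', ← Module.End.mul_apply, ← map_mul,
      opDouble_counit]
  map_oneB := rfl
  equiv_tmul φ h := by
    rw [tensorEquiv_apply, LinearMap.flip_apply, TensorProduct.mk_apply]
    generalize (r : H ⊗[k] H) = t
    induction t with
    | zero => simp
    | add a b ha hb => simp only [map_add, LinearMap.add_apply, ha, hb]
    | tmul x y =>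
      rw [opTensor_tmul_apply, hitTensor_tmul, doubleMul_tmul, ← opDouble_counit h,
        ← Module.End.mul_apply (opDouble k H y), ← map_mul, opDouble_counit, opDual_tmul,
        isAlgebraStructure_dualMul.mul_one]
  equiv_twist h φ := by
    -- The action of `r` in `g` cancels the outer `r⁻¹` of `R'`, leaving `opDouble h` applied to
    -- `f(φ)`.
    rw [tensorEquiv_apply, LinearMap.flip_apply, TensorProduct.mk_apply, doubleMul_tmul,
      opDual_counit, Module.End.one_apply, twistMap_tmul, ← Module.End.mul_apply, ← map_mul,
      Units.mul_inv, map_one, Module.End.one_apply, hitTensor_eq_opTensor_one]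

end SQT
end HopfDual

theorem mainTheorem2 {k : Type*} {H : Type*} [Field k] [Ring H] [HopfAlgebra k H]
    [FiniteDimensional k H] (r : (H ⊗[k] H)ˣ) (hr : HopfDual.SatisfiesSQT (r : H ⊗[k] H)) :
    -- the product `*` makes `H*` an associative algebra with unit `ε`
    HopfDual.IsAlgebraStructure (HopfDual.starMul (r : H ⊗[k] H))
      (Coalgebra.counit : Module.Dual k H) ∧
    -- `R'(h ⊗ φ) = h_1 ⇀ φ ↼ S⁻¹(u^1 h_3 r^1) ⊗ u^2 h_2 r^2`, where `r⁻¹ = u^1 ⊗ u^2`, is a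
    -- twisting map between this algebra and `H`
    HopfDual.IsTwistingMap (HopfDual.starMul (r : H ⊗[k] H)) (Coalgebra.counit : Module.Dual k H)
      (LinearMap.mul k H) 1
      (HopfDual.twistMap ((r⁻¹ : (H ⊗[k] H)ˣ) : H ⊗[k] H) (r : H ⊗[k] H)) ∧
    -- the twisted tensor product and the Drinfeld double are associative unital algebras
    HopfDual.IsAlgebraStructure
      (HopfDual.twistedMul (HopfDual.starMul (r : H ⊗[k] H)) (LinearMap.mul k H)
        (HopfDual.twistMap ((r⁻¹ : (H ⊗[k] H)ˣ) : H ⊗[k] H) (r : H ⊗[k] H)))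
      ((Coalgebra.counit : Module.Dual k H) ⊗ₜ[k] (1 : H)) ∧
    HopfDual.IsAlgebraStructure (HopfDual.doubleMul k H)
      ((Coalgebra.counit : Module.Dual k H) ⊗ₜ[k] (1 : H)) ∧
    -- `φ ⊗ h ↦ φ ↼ S⁻¹(r^1) ⊗ r^2 h` is an algebra isomorphism between them
    ∃ g : (Module.Dual k H ⊗[k] H) ≃ₗ[k] (Module.Dual k H ⊗[k] H),
      (∀ (φ : Module.Dual k H) (h : H),
        g (φ ⊗ₜ[k] h) = HopfDual.hitTensor φ ((r : H ⊗[k] H) * ((1 : H) ⊗ₜ[k] h))) ∧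
      g ((Coalgebra.counit : Module.Dual k H) ⊗ₜ[k] (1 : H)) =
        (Coalgebra.counit : Module.Dual k H) ⊗ₜ[k] (1 : H) ∧
      ∀ x y : Module.Dual k H ⊗[k] H,
        g (HopfDual.twistedMul (HopfDual.starMul (r : H ⊗[k] H)) (LinearMap.mul k H)
            (HopfDual.twistMap ((r⁻¹ : (H ⊗[k] H)ˣ) : H ⊗[k] H) (r : H ⊗[k] H)) x y) =
          HopfDual.doubleMul k H (g x) (g y) := by
  have hD := HopfDual.isAlgebraStructure_doubleMul (k := k) (H := H)
  have F := hr.isFactorization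
  -- `H` is nonzero because `ε(1) = 1`.
  have h1 : (1 : H) ≠ 0 := fun h => by
    have := congrArg (Coalgebra.counit (R := k)) h
    simp at this
  refine ⟨F.isAlgebraStructure_left hD h1, F.isTwistingMap hD,
    F.isAlgebraStructure_twistedMul hD, hD, HopfDual.tensorEquiv r, fun φ h => ?_,
    F.equiv_one hD, F.equiv_twistedMul hD⟩
  rw [HopfDual.tensorEquiv_apply, HopfDual.hitTensor_eq_opTensor]
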